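/- Let $1\le r\le n$ be integers and let $e\in\mathbb R^n$. Let $d_1,\dots,d_n:\mathbb R^n\to\mathbb R$ be $C^1$ maps such that $d_i$ depends only on $(x_i,x_{i+1})$ for $i<n$, $d_n$ depends only on $x_n$ (so $\partial d_n/\partial x_{n+1}:=0$), and $d_i(e)=0$ for all $i$. Assume that there are constants $\eta_1,c>0$ such that for all $x\in\mathbb R^n$ and all $i$ $$\frac{\partial d_i}{\partial x_i}>0,\qquad \frac{\partial d_i}{\partial x_{i+1}}<0\ \ (i<n),\qquad \frac{\partial d_i}{\partial x_i}+\frac{\partial d_i}{\partial x_{i+1}}\ge\eta_1,\qquad \max\Big\{\Big|\frac{\partial d_i}{\partial x_i}\Big|,\Big|\frac{\partial d_i}{\partial x_{i+1}}\Big|\Big\}\le c .$$ Let $\bar\epsilon>0$ and let $\bar k_1,\dots,\bar k_n\in\mathbb R$ satisfy $-\bar k_i+2\bar\epsilon c(r-1)<0$ for all $i$. (In the platoon with feedback gains $k_i$, $\bar k_i=k_i/k_{\min}$ with $k_{\min}=\min_i k_i$, and $\epsilon=1/k_{\min}$.) Put $f=(-d_1,\dots,-d_n)^T$ and $h_i=\sum_{j=1}^{i-1}d_j$;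 let $G\in\mathbb R^{n\times n}$ have $G_{ii}=-1$, $G_{i+1,i}=1$ and all other entries $0$; let $A\in\mathbb R^{n\times n}$ have $A_{ii}=-\bar k_i$, $A_{i,i-r}=\bar k_i$ (for $i>r$) and all other entries $0$. For $\epsilon>0$ consider $$\dot x=f(x)+Gy,\qquad \epsilon\,\dot y=Ay-\epsilon\frac{\partial h}{\partial x}(x)\,\big(f(x)+Gy\big)+\epsilon w(t),\qquad t\ge 0,$$ where $w:[0,\infty)\to\mathbb R^n$ is measurable and solutions are understood in the sense of Carathéodory. Let $m=\lceil n/r\rceil$, and for a diagonal matrix $D\in\mathbb R^{m\times m}$ with positive diagonal entries put $|a|_*=\big|D\,(|a^1|_\infty,\dots,|a^m|_\infty)^T\big|_2$, where $a^1,\dots,a^m$ are the consecutive blocks of $a\in\mathbb R^n$, of length $r$ except possibly the last one, of length $n-(m-1)r$. Let $\|M\|_*=\max_{|a|_*=1}|Ma|_*$ be the induced matrix norm, $\mu_*(M)=\lim_{s\to0^+}(\|I+sM\|_*-1)/s$ the induced matrix measure, $\|G\|_{\infty,*}=\max_{a\ne0}|Ga|_\infty/|a|_*$, and $\|u\|_*=\operatorname{ess\,sup}_{t\ge0}|u(t)|_*$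 for a signal $u$; let $w_t$ be the signal equal to $w$ on $[0,t]$ and to $0$ on $(t,\infty)$. Then there are a diagonal $D$ with positive diagonal entries and $\eta_2>0$ such that $$\mu_*\Big(A-\epsilon\frac{\partial h}{\partial x}(x)\,G\Big)\le-\eta_2\qquad\text{for all }\epsilon\in(0,\bar\epsilon]\text{ and all }x\in\mathbb R^n. \tag{1}$$ Moreover, for every such pair $(D,\eta_2)$ satisfying (1) and all $\delta,\sigma>0$ there is $\epsilon^*\in(0,\bar\epsilon]$ such that, for every $\epsilon\in(0,\epsilon^*]$, all initial values and every $w$ with $\max\{|x(0)-e|_\infty,|y(0)|_*,\|w\|_*\}\le\delta$, a solution exists on $[0,\infty)$, and every solution satisfies, for all $t\ge0$ (for all $t\in[0,T]$ if it is only given on $[0,T]$), $$|x(t)-e|_\infty\le e^{-\eta_1t}|x(0)-e|_\infty+\frac{\epsilon\,\|G\|_{\infty,*}\|w_t\|_*}{\eta_1\eta_2}+\sigma,\qquad |y(t)|_*\le e^{-\eta_2t/\epsilon}|y(0)|_*+\frac{\epsilon\,\|w_t\|_*}{\eta_2}+\sigma .$$ -/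

import Mathlib

open Set Filter Topology MeasureTheory

noncomputable section

namespace Platoon

/-! Vectors of `ℝⁿ` are `Fin n → ℝ`, whose Mathlib norm `‖·‖` is the maximum norm `|·|_∞`.
Indices start at `0`: vehicle `i + 1` of the platoon is the index `i : Fin n`. -/

/-- The partial derivative `∂g/∂x_j` at `x`. -/
def pderiv {n : ℕ} (g : (Fin n → ℝ) → ℝ) (j : Fin n) (x : Fin n → ℝ) : ℝ :=
  fderiv ℝ g x (Pi.single j 1)

/-- The Jacobian matrix of `F` at `x`. -/
def jacobian {n : ℕ} (F : (Fin n → ℝ) → Fin n → ℝ) (x : Fin n → ℝ) :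
    Matrix (Fin n) (Fin n) ℝ :=
  Matrix.of fun i j => pderiv (fun x' => F x' i) j x

/-- `d_i` is a function of `x_i` and `x_{i+1}` only (of `x_n` only for the last index). -/
def DependsOnNeighbours {n : ℕ} (d : Fin n → (Fin n → ℝ) → ℝ) : Prop :=
  ∀ (i : Fin n) (x x' : Fin n → ℝ), x i = x' i →
    (∀ j : Fin n, (j : ℕ) = i + 1 → x j = x' j) → d i x = d i x'

/-- `∂d_i/∂x_{i+1}`, which is `0` for the last index. -/
def pderivNext {n : ℕ} (d : Fin n → (Fin n → ℝ) → ℝ) (i : Fin n) (x : Fin n → ℝ) : ℝ :=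
  if h : (i : ℕ) + 1 < n then pderiv (d i) ⟨i + 1, h⟩ x else 0

/-- The sign and sum conditions on the maps `d_i`; the condition `∂d_i/∂x_{i+1} < 0` is void
for the last index. -/
def SignSumCondition {n : ℕ} (d : Fin n → (Fin n → ℝ) → ℝ) (η₁ : ℝ) : Prop :=
  ∀ (i : Fin n) (x : Fin n → ℝ),
    0 < pderiv (d i) i x ∧
    ((i : ℕ) + 1 < n → pderivNext d i x < 0) ∧
    η₁ ≤ pderiv (d i) i x + pderivNext d i x

/-- The bound on the partial derivatives of the maps `d_i`. -/
def BoundCondition {n : ℕ} (d : Fin n → (Fin n → ℝ) → ℝ) (c : ℝ) : Prop :=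
  ∀ (i : Fin n) (x : Fin n → ℝ), max |pderiv (d i) i x| |pderivNext d i x| ≤ c

/-- `f = (-d_1, …, -d_n)`. -/
def f {n : ℕ} (d : Fin n → (Fin n → ℝ) → ℝ) (x : Fin n → ℝ) : Fin n → ℝ :=
  fun i => -d i x

/-- `h_i = ∑_{j < i} d_j`. -/
def h {n : ℕ} (d : Fin n → (Fin n → ℝ) → ℝ) (x : Fin n → ℝ) : Fin n → ℝ :=
  fun i => ∑ j ∈ Finset.univ.filter (fun j : Fin n => j < i), d j x

/-- `-1` on the diagonal, `1` on the first subdiagonal. -/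
def G (n : ℕ) : Matrix (Fin n) (Fin n) ℝ :=
  Matrix.of fun i j => if i = j then -1 else if (i : ℕ) = j + 1 then 1 else 0

/-- `-k̄_i` on the diagonal, `k̄_i` at the positions `(i, i - r)`. -/
def A {n : ℕ} (r : ℕ) (kbar : Fin n → ℝ) : Matrix (Fin n) (Fin n) ℝ :=
  Matrix.of fun i j => if i = j then -kbar i else if (i : ℕ) = j + r then kbar i else 0

/-- `J̄(x) = A - ε (∂h/∂x) G`. -/
def Jbar {n : ℕ} (d : Fin n → (Fin n → ℝ) → ℝ) (r : ℕ) (kbar : Fin n → ℝ) (ε : ℝ)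
    (x : Fin n → ℝ) : Matrix (Fin n) (Fin n) ℝ :=
  A r kbar - ε • (jacobian (h d) x * G n)

/-- The maximum norm of the `k`-th block of `a`, where `a` is cut into consecutive blocks of
length `r` (the last one may be shorter). -/
def blockNorm {n : ℕ} (r : ℕ) (a : Fin n → ℝ) (k : ℕ) : ℝ :=
  ‖fun i : {i : Fin n // (i : ℕ) / r = k} => a i‖

/-- The norm `|a|_* = |D (|a¹|_∞, …, |a^m|_∞)|_2`, with `m = ⌈n / r⌉` and `D = diag(q)`. -/
def starNorm {n r : ℕ} (q : Fin (n ⌈/⌉ r) → ℝ) (a : Fin n → ℝ) : ℝ :=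
  ‖WithLp.toLp 2 (fun k : Fin (n ⌈/⌉ r) => q k * blockNorm r a k)‖

/-- The matrix norm induced by the vector norm `N`. -/
def inducedNorm {n : ℕ} (N : (Fin n → ℝ) → ℝ) (M : Matrix (Fin n) (Fin n) ℝ) : ℝ :=
  sSup ((fun a => N (M.mulVec a)) '' {a | N a = 1})

/-- The matrix measure induced by the vector norm `N`. -/
def matrixMeasure {n : ℕ} (N : (Fin n → ℝ) → ℝ) (M : Matrix (Fin n) (Fin n) ℝ) : ℝ :=
  limUnder (𝓝[>] (0 : ℝ)) fun s => (inducedNorm N (1 + s • M) - 1) / s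

/-- `‖G‖_{∞,*} = max_{a ≠ 0} |G a|_∞ / |a|_*`. -/
def normGInftyStar {n r : ℕ} (q : Fin (n ⌈/⌉ r) → ℝ) : ℝ :=
  sSup ((fun a => ‖(G n).mulVec a‖ / starNorm q a) '' {a | a ≠ 0})

/-- `D = diag(q)` is positive definite, `η₂ > 0`, and `μ_*(J̄(x)) ≤ -η₂` for all
`ε ∈ (0, ε̄]` and all `x`. -/
def IsContractionPair {n : ℕ} (d : Fin n → (Fin n → ℝ) → ℝ) (r : ℕ) (kbar : Fin n → ℝ)
    (εbar : ℝ) (q : Fin (n ⌈/⌉ r) → ℝ) (η₂ : ℝ) : Prop :=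
  (∀ k, 0 < q k) ∧ 0 < η₂ ∧
    ∀ ε ∈ Ioc 0 εbar, ∀ x : Fin n → ℝ,
      matrixMeasure (starNorm q) (Jbar d r kbar ε x) ≤ -η₂

/-- The signal norm `ess sup_{t ≥ 0} N (u t)`, with values in `[0, ∞]`. -/
def signalNorm {n : ℕ} (N : (Fin n → ℝ) → ℝ) (u : ℝ → Fin n → ℝ) : ENNReal :=
  essSup (fun t => ENNReal.ofReal (N (u t))) (volume.restrict (Ici (0 : ℝ)))

/-- The truncation `u_t`: equal to `u` on `[0, t]` and `0` afterwards. -/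
def truncate {n : ℕ} (t : ℝ) (u : ℝ → Fin n → ℝ) : ℝ → Fin n → ℝ :=
  (Icc 0 t).indicator u

/-- `(x, y)` is a (Carathéodory) solution on `[0, T]` of
`dx/dt = f(x) + G y`, `ε dy/dt = A y - ε (∂h/∂x) (f(x) + G y) + ε w`
(the second one is `dy/dτ = …` in the fast time `τ = t / ε`), written as an integral equation. -/
structure IsSolutionOn {n : ℕ} (d : Fin n → (Fin n → ℝ) → ℝ) (r : ℕ) (kbar : Fin n → ℝ)
    (ε : ℝ) (w : ℝ → Fin n → ℝ) (T : ℝ) (x y : ℝ → Fin n → ℝ) : Prop where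
  integrable_input : IntervalIntegrable w volume 0 T
  continuousOn_x : ContinuousOn x (Icc 0 T)
  continuousOn_y : ContinuousOn y (Icc 0 T)
  eq_x : ∀ t ∈ Icc 0 T, x t = x 0 + ∫ s in (0 : ℝ)..t, (f d (x s) + (G n).mulVec (y s))
  eq_y : ∀ t ∈ Icc 0 T, y t = y 0 + ∫ s in (0 : ℝ)..t,
    ε⁻¹ • ((A r kbar).mulVec (y s)
      - ε • (jacobian (h d) (x s)).mulVec (f d (x s) + (G n).mulVec (y s)) + ε • w s)

end Platoon

end

namespace Platoon

/-! Contraction. The matrix `J̄ = A - ε (∂h/∂x) G` is lower triangular. The entries `k̄_i` of `A`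
below the diagonal sit `r` places to the left, hence in an earlier block, so inside a block only the
`ε`-term contributes off the diagonal: at most `r - 1` entries per row, each at most `2 ε̄ c`. The
condition on `k̄` therefore makes every diagonal block contracting in the maximum norm. The weights
`q_k = θ ^ k` with small `θ` damp the coupling from earlier blocks, which gives (1); see
`blockNorm_add_smul_mulVec_le` and `starNorm_add_smul_mulVec_le`.

Estimates. With `X = |x - e|_∞` and `Y = |y|_*`, upper Dini derivatives satisfy `X' ≤ -η₁ X + g Y`
and `Y' ≤ -(η₂/ε) Y + C X + ω`. The rate of `Y` blows up as `ε → 0` while `g` and `C` do not depend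
on `ε`, so a combination `X + l Y` with `l = O(ε)` decays (`comparison_estimate`). It first bounds
`X` uniformly; inserting this bound in both inequalities leaves errors `O(ε)`, absorbed by `σ`.

Existence. The field contains `∂h/∂x`, which is only continuous in `x`. In the variable `y + h(x) -
∫ w` this term disappears and the right-hand side becomes globally Lipschitz, so a Picard iteration
in an exponentially weighted norm works on all of `[0, ∞)`. -/

/-! ### Dini derivatives and a Gronwall comparison -/

/-- The upper right Dini derivative of `φ` at `s` is at most `L`. -/
def UpperDiniLE (φ : ℝ → ℝ) (s L : ℝ) : Prop :=
  ∀ r, L < r → ∀ᶠ z in 𝓝[>] s, φ z ≤ φ s + (z - s) * r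

theorem UpperDiniLE.mono {φ : ℝ → ℝ} {s L L' : ℝ} (hφ : UpperDiniLE φ s L) (hL : L ≤ L') :
    UpperDiniLE φ s L' := fun r hr => hφ r (hL.trans_lt hr)

theorem UpperDiniLE.add_const_mul {φ ψ : ℝ → ℝ} {s L L' l : ℝ} (hl : 0 ≤ l)
    (hφ : UpperDiniLE φ s L) (hψ : UpperDiniLE ψ s L') :
    UpperDiniLE (fun t => φ t + l * ψ t) s (L + l * L') := by
  intro r hr
  -- The slack is shared as `κ + l κ`; this also covers `l = 0`.
  set κ := (r - (L + l * L')) / (1 + l) with hκ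
  have hκ0 : 0 < κ := div_pos (by linarith) (by linarith)
  have hκ1 : κ * (1 + l) = r - (L + l * L') := div_mul_cancel₀ _ (by linarith)
  filter_upwards [hφ (L + κ) (by linarith), hψ (L' + κ) (by linarith)] with z h1 h2
  have h3 := mul_le_mul_of_nonneg_left h2 hl
  have h4 : r = L + κ + l * (L' + κ) := by linarith
  rw [h4]
  linarith

/-- Gronwall's inequality with the negative constant `-α`. The exact bound has the forcing term
`(B/α)(1 - e^{-αt})`, whose negative part is dropped using `0 ≤ B`. -/
theorem le_of_upperDiniLE {φ : ℝ → ℝ} {T α B : ℝ} (hα : 0 < α) (hB : 0 ≤ B)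
    (hcont : ContinuousOn φ (Icc 0 T))
    (hφ : ∀ s ∈ Ico 0 T, UpperDiniLE φ s (-α * φ s + B)) {t : ℝ} (ht : t ∈ Icc 0 T) :
    φ t ≤ Real.exp (-α * t) * φ 0 + B / α := by
  have key := le_gronwallBound_of_liminf_deriv_right_le (f := φ) (f' := fun s => -α * φ s + B)
    (δ := φ 0) (K := -α) (ε := B) hcont ?_ le_rfl (fun x _ => le_rfl) t ht
  · rw [gronwallBound_of_K_ne_0 (by linarith), sub_zero] at key
    beta_reduce at key
    have h1 : B / -α * (Real.exp (-α * t) - 1) = B / α - B / α * Real.exp (-α * t) := by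
      rw [div_neg]; ring
    have h2 : 0 ≤ B / α * Real.exp (-α * t) := by positivity
    rw [h1] at key
    linarith
  · intro x hx r hr
    refine Eventually.frequently ?_
    obtain ⟨r', hr1, hr2⟩ := exists_between hr
    filter_upwards [hφ x hx r' hr1, self_mem_nhdsWithin] with z hz hzx
    have hzx' : 0 < z - x := sub_pos.2 hzx
    rw [inv_mul_lt_iff₀ hzx']
    nlinarith

/-! ### Seminorms along absolutely continuous curves -/

section Average

variable {E : Type*} [NormedAddCommGroup E] [NormedSpace ℝ E] [CompleteSpace E]

/-- The mean value of `g` lies in every closed convex set containing almost all its values, here the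
`N`-ball of radius `B` about `v`. -/
theorem seminorm_integral_sub_le (N : Seminorm ℝ E) (hN : Continuous N) {g : ℝ → E} {a b : ℝ}
    (hab : a < b) (hg : IntervalIntegrable g volume a b) (v : E) {B : ℝ}
    (hB : ∀ᵐ u ∂volume.restrict (Ioc a b), N (g u - v) ≤ B) :
    N ((∫ u in a..b, g u) - (b - a) • v) ≤ (b - a) * B := by
  have hba : 0 < b - a := sub_pos.2 hab
  have hconv : Convex ℝ {u : E | N (u - v) ≤ B} := by
    have : {u : E | N (u - v) ≤ B} = N.closedBall v B := by
      ext u; simp [Seminorm.mem_closedBall]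
    rw [this]; exact N.convex_closedBall v B
  have hclosed : IsClosed {u : E | N (u - v) ≤ B} :=
    isClosed_le (hN.comp (continuous_id.sub continuous_const)) continuous_const
  have hmem := hconv.set_average_mem (μ := volume) (t := Ioc a b) (f := g) hclosed
    (by simp [hab]) (by simp) hB ((intervalIntegrable_iff_integrableOn_Ioc_of_le hab.le).1 hg)
  rw [← uIoc_of_le hab.le, interval_average_eq] at hmem
  have h2 : (∫ u in a..b, g u) - (b - a) • v
      = (b - a) • ((b - a)⁻¹ • (∫ u in a..b, g u) - v) := by
    rw [smul_sub, smul_smul, mul_inv_cancel₀ hba.ne', one_smul]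
  rw [h2, map_smul_eq_mul, Real.norm_of_nonneg hba.le]
  exact mul_le_mul_of_nonneg_left hmem hba.le

/-- Dini derivative of a seminorm along an absolutely continuous curve with velocity `m + p`,
where `m` is continuous and `p` is essentially bounded. -/
theorem upperDiniLE_seminorm (N : Seminorm ℝ E) (hN : Continuous N) {y m p : ℝ → E} {T B L : ℝ}
    (hm : ContinuousOn m (Icc 0 T)) (hp : IntervalIntegrable p volume 0 T)
    (hpB : ∀ᵐ u ∂volume.restrict (Icc 0 T), N (p u) ≤ B)
    (hy : ∀ t ∈ Icc 0 T, y t = y 0 + ∫ u in (0 : ℝ)..t, (m u + p u))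
    {s : ℝ} (hs : s ∈ Ico 0 T)
    (hL : ∀ r, L < r → ∀ᶠ τ in 𝓝[>] (0 : ℝ), N (y s + τ • m s) ≤ N (y s) + τ * r) :
    UpperDiniLE (fun t => N (y t)) s (L + B) := by
  intro r hr
  set κ := (r - (L + B)) / 2 with hκ
  have hκ0 : 0 < κ := by rw [hκ]; linarith
  have hT : 0 ≤ T := hs.1.trans hs.2.le
  have hint : IntervalIntegrable (fun u => m u + p u) volume 0 T :=
    (hm.intervalIntegrable_of_Icc hT).add hp
  have e1 : ∀ᶠ z in 𝓝[>] s, N (y s + (z - s) • m s) ≤ N (y s) + (z - s) * (L + κ) := by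
    have : Tendsto (fun z : ℝ => z - s) (𝓝[>] s) (𝓝[>] 0) := by
      refine tendsto_nhdsWithin_iff.2 ⟨?_, ?_⟩
      · have : Tendsto (fun z : ℝ => z - s) (𝓝 s) (𝓝 (s - s)) :=
          (continuous_id.sub continuous_const).tendsto s
        rw [sub_self] at this
        exact this.mono_left nhdsWithin_le_nhds
      · filter_upwards [self_mem_nhdsWithin] with z hz
        exact sub_pos.2 (mem_Ioi.1 hz)
    exact this.eventually (hL (L + κ) (by linarith))
  have e2 : ∀ᶠ z in 𝓝[>] s, z ≤ T :=
    (Ioc_mem_nhdsGT hs.2 |> fun hh => by filter_upwards [hh] with z hz using hz.2)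
  have e3 : ∀ᶠ u in 𝓝[Icc 0 T] s, N (m u - m s) < κ := by
    have hc : ContinuousWithinAt (fun u => N (m u - m s)) (Icc 0 T) s :=
      hN.continuousAt.comp_continuousWithinAt
        ((hm s ⟨hs.1, hs.2.le⟩).sub continuousWithinAt_const)
    have : N (m s - m s) < κ := by simpa using hκ0
    exact hc.eventually (gt_mem_nhds this)
  obtain ⟨ρ, hρ, hρ'⟩ := Metric.mem_nhdsWithin_iff.1 e3
  have e4 : ∀ᶠ z in 𝓝[>] s, z < s + ρ := by
    filter_upwards [Ioo_mem_nhdsGT (show s < s + ρ by linarith)] with z hz using hz.2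
  filter_upwards [e1, e2, e4, self_mem_nhdsWithin] with z h1 h2 h4 hz
  have hz' : s < z := hz
  have hsub : Ioc s z ⊆ Icc 0 T := fun u hu => ⟨hs.1.trans hu.1.le, hu.2.trans h2⟩
  have hi1 : IntervalIntegrable (fun u => m u + p u) volume 0 s :=
    hint.mono_set (by rw [uIcc_of_le hs.1, uIcc_of_le hT]; exact Icc_subset_Icc le_rfl hs.2.le)
  have hi2 : IntervalIntegrable (fun u => m u + p u) volume s z :=
    hint.mono_set (by rw [uIcc_of_le hz'.le, uIcc_of_le hT]; exact Icc_subset_Icc hs.1 h2)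
  have hyz : y z = y s + ∫ u in s..z, (m u + p u) := by
    rw [hy z ⟨hs.1.trans hz'.le, h2⟩, hy s ⟨hs.1, hs.2.le⟩, add_assoc,
      intervalIntegral.integral_add_adjacent_intervals hi1 hi2]
  have havg := seminorm_integral_sub_le N hN hz' hi2 (m s) (B := B + κ) (by
    filter_upwards [ae_restrict_of_ae_restrict_of_subset hsub hpB,
      ae_restrict_mem measurableSet_Ioc] with u hu1 hu2
    have h5 : N (m u - m s) < κ := hρ' ⟨by
      rw [Metric.mem_ball, Real.dist_eq, abs_of_pos (sub_pos.2 hu2.1)]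
      linarith [hu2.2], hsub hu2⟩
    calc N (m u + p u - m s) = N (p u + (m u - m s)) := by congr 1; abel
      _ ≤ N (p u) + N (m u - m s) := map_add_le_add _ _ _
      _ ≤ B + κ := by linarith)
  calc N (y z) = N ((y s + (z - s) • m s) + ((∫ u in s..z, (m u + p u)) - (z - s) • m s)) := by
        rw [hyz]; congr 1; abel
    _ ≤ N (y s + (z - s) • m s) + N ((∫ u in s..z, (m u + p u)) - (z - s) • m s) :=
        map_add_le_add _ _ _
    _ ≤ N (y s) + (z - s) * (L + κ) + (z - s) * (B + κ) := add_le_add h1 havg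
    _ = N (y s) + (z - s) * r := by rw [hκ]; ring

end Average

/-! ### Induced norms and matrix measures -/

section MatrixMeasure

variable {n : ℕ} {N : Seminorm ℝ (Fin n → ℝ)} {Q : ℝ}

/-- Without this bound the real `sSup` in `inducedNorm` could take its default value `0`. -/
theorem bddAbove_image_of_le (hQ : ∀ a, ‖a‖ ≤ Q * N a) {C : ℝ} (hC : ∀ a, N a ≤ C * ‖a‖)
    (hC0 : 0 ≤ C) (M : Matrix (Fin n) (Fin n) ℝ) :
    BddAbove ((fun a => N (M.mulVec a)) '' {a | N a = 1}) := by
  refine ⟨C * (‖(Matrix.mulVecLin M).toContinuousLinearMap‖ * Q), ?_⟩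
  rintro _ ⟨a, ha, rfl⟩
  have ha' : N a = 1 := ha
  refine (hC _).trans (mul_le_mul_of_nonneg_left ?_ hC0)
  refine ((Matrix.mulVecLin M).toContinuousLinearMap.le_opNorm a).trans ?_
  refine mul_le_mul_of_nonneg_left ?_ (norm_nonneg _)
  simpa [ha'] using hQ a

theorem le_inducedNorm (hQ : ∀ a, ‖a‖ ≤ Q * N a) {C : ℝ} (hC : ∀ a, N a ≤ C * ‖a‖)
    (hC0 : 0 ≤ C) (M : Matrix (Fin n) (Fin n) ℝ) (a : Fin n → ℝ) :
    N (M.mulVec a) ≤ inducedNorm N M * N a := by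
  rcases (apply_nonneg N a).eq_or_lt with h0 | h0
  · have : a = 0 := by
      rw [← norm_le_zero_iff]; simpa [← h0] using hQ a
    simp [this]
  · have h1 : N ((N a)⁻¹ • a) = 1 := by
      rw [map_smul_eq_mul, Real.norm_of_nonneg (inv_nonneg.2 h0.le), inv_mul_cancel₀ h0.ne']
    have h2 := le_csSup (bddAbove_image_of_le hQ hC hC0 M) ⟨_, h1, rfl⟩
    simp only [Matrix.mulVec_smul, map_smul_eq_mul, Real.norm_of_nonneg (inv_nonneg.2 h0.le)] at h2
    rwa [inv_mul_le_iff₀ h0, mul_comm] at h2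

theorem inducedNorm_nonneg (M : Matrix (Fin n) (Fin n) ℝ) : 0 ≤ inducedNorm N M :=
  Real.sSup_nonneg (by rintro _ ⟨a, -, rfl⟩; exact apply_nonneg _ _)

theorem inducedNorm_le {M : Matrix (Fin n) (Fin n) ℝ} {B : ℝ} (hB0 : 0 ≤ B)
    (hB : ∀ a, N (M.mulVec a) ≤ B * N a) : inducedNorm N M ≤ B := by
  refine Real.sSup_le ?_ hB0
  rintro _ ⟨a, ha, rfl⟩
  have ha' : N a = 1 := ha
  simpa [ha'] using hB a

/-- `limUnder` is meaningful only if the limit exists. It does: `s ↦ ‖I + s M‖` is convex, so the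
difference quotient is monotone, and it is bounded below by `-‖M‖`. -/
theorem tendsto_matrixMeasure (hn : 0 < n) (hQ : ∀ a, ‖a‖ ≤ Q * N a) {C : ℝ}
    (hC : ∀ a, N a ≤ C * ‖a‖) (hC0 : 0 ≤ C) (M : Matrix (Fin n) (Fin n) ℝ) :
    Tendsto (fun s : ℝ => (inducedNorm N (1 + s • M) - 1) / s) (𝓝[>] 0)
      (𝓝 (matrixMeasure N M)) := by
  refine tendsto_nhds_limUnder ?_
  have hmono : MonotoneOn (fun s : ℝ => (inducedNorm N (1 + s • M) - 1) / s) (Ioi 0) := by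
    intro s hs t ht hst
    have hs' : 0 < s := hs
    have ht' : 0 < t := ht
    have hle1 : s / t ≤ 1 := (div_le_one ht').2 hst
    -- For `s ≤ t`, `I + s M` is a convex combination of `I` and `I + t M`.
    have hle : inducedNorm N (1 + s • M)
        ≤ (1 - s / t) + s / t * inducedNorm N (1 + t • M) := by
      refine inducedNorm_le (add_nonneg (by linarith)
        (mul_nonneg (by positivity) (inducedNorm_nonneg _))) fun a => ?_
      have h1 : (1 + s • M).mulVec a
          = (1 - s / t) • a + (s / t) • (1 + t • M).mulVec a := by
        rw [Matrix.add_mulVec, Matrix.add_mulVec, Matrix.one_mulVec, Matrix.smul_mulVec,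
          Matrix.smul_mulVec, smul_add, smul_smul, div_mul_cancel₀ _ ht'.ne', sub_smul, one_smul]
        abel
      rw [h1]
      refine (map_add_le_add _ _ _).trans ?_
      rw [map_smul_eq_mul, map_smul_eq_mul, Real.norm_of_nonneg (by linarith),
        Real.norm_of_nonneg (by positivity), add_mul, mul_assoc]
      gcongr
      exact le_inducedNorm hQ hC hC0 _ a
    change _ / s ≤ _ / t
    rw [div_le_div_iff₀ hs' ht']
    have h2 := mul_le_mul_of_nonneg_right hle ht'.le
    have h3 : ((1 - s / t) + s / t * inducedNorm N (1 + t • M)) * t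
        = t - s + s * inducedNorm N (1 + t • M) := by field_simp
    rw [h3] at h2
    linarith
  -- This is where `0 < n` enters: in dimension `0` the unit sphere is empty, the induced norm is
  -- `0` and the quotient `-1/s` diverges.
  obtain ⟨a, ha⟩ : ∃ a : Fin n → ℝ, a ≠ 0 := by
    refine ⟨Pi.single ⟨0, hn⟩ 1, ?_⟩
    simp
  have ha0 : 0 < N a := by
    rcases (apply_nonneg N a).eq_or_lt with h0 | h0
    · exact absurd (by rw [← norm_le_zero_iff]; simpa [← h0] using hQ a) ha
    · exact h0
  refine ⟨_, hmono.tendsto_nhdsGT ⟨-inducedNorm N M, ?_⟩⟩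
  rintro _ ⟨s, hs, rfl⟩
  have hs' : 0 < s := hs
  change _ ≤ _ / s
  rw [le_div_iff₀ hs']
  have h1 := le_inducedNorm hQ hC hC0 (1 + s • M) a
  have h2 := le_inducedNorm hQ hC hC0 M a
  have h3 : a = (1 + s • M).mulVec a + (-s) • M.mulVec a := by
    rw [Matrix.add_mulVec, Matrix.one_mulVec, Matrix.smul_mulVec, neg_smul]; abel
  have h4 : N a ≤ N ((1 + s • M).mulVec a) + s * N (M.mulVec a) := by
    conv_lhs => rw [h3]
    refine (map_add_le_add _ _ _).trans ?_
    rw [map_smul_eq_mul, norm_neg, Real.norm_of_nonneg hs'.le]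
  have h5 : 1 * N a ≤ (inducedNorm N (1 + s • M) + s * inducedNorm N M) * N a := by
    have := mul_le_mul_of_nonneg_left h2 hs'.le
    linarith
  have h6 := le_of_mul_le_mul_right h5 ha0
  linarith

theorem matrixMeasure_le (hn : 0 < n) (hQ : ∀ a, ‖a‖ ≤ Q * N a) {C : ℝ}
    (hC : ∀ a, N a ≤ C * ‖a‖) (hC0 : 0 ≤ C) {M : Matrix (Fin n) (Fin n) ℝ} {η : ℝ}
    (h : ∀ᶠ s in 𝓝[>] (0 : ℝ), ∀ a, N (a + s • M.mulVec a) ≤ (1 - s * η) * N a) :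
    matrixMeasure N M ≤ -η := by
  refine le_of_tendsto (tendsto_matrixMeasure hn hQ hC hC0 M) ?_
  have h1 : ∀ᶠ s in 𝓝[>] (0 : ℝ), 0 ≤ 1 - s * η := by
    have : Tendsto (fun s : ℝ => 1 - s * η) (𝓝 0) (𝓝 (1 - 0 * η)) :=
      (by fun_prop : Continuous fun s : ℝ => 1 - s * η).tendsto 0
    exact nhdsWithin_le_nhds (this.eventually_const_le (by simp))
  filter_upwards [h, self_mem_nhdsWithin, h1] with s hs hs0 hs1
  have hs0' : 0 < s := hs0
  rw [div_le_iff₀ hs0']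
  have := inducedNorm_le (N := N) (M := 1 + s • M) hs1 (fun a => by
    rw [Matrix.add_mulVec, Matrix.one_mulVec, Matrix.smul_mulVec]; exact hs a)
  linarith

/-- Turns a bound on the measure back into a bound on one Euler step, uniform in the vector, at the
price of an arbitrarily small loss in the rate. -/
theorem eventually_le_of_matrixMeasure_le (hn : 0 < n) (hQ : ∀ a, ‖a‖ ≤ Q * N a) {C : ℝ}
    (hC : ∀ a, N a ≤ C * ‖a‖) (hC0 : 0 ≤ C) {M : Matrix (Fin n) (Fin n) ℝ} {μ ν : ℝ}
    (h : matrixMeasure N M ≤ μ) (hμν : μ < ν) :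
    ∀ᶠ s in 𝓝[>] (0 : ℝ), ∀ a, N (a + s • M.mulVec a) ≤ (1 + s * ν) * N a := by
  filter_upwards [(tendsto_matrixMeasure hn hQ hC hC0 M).eventually
    (gt_mem_nhds (h.trans_lt hμν)), self_mem_nhdsWithin] with s hs hs0 a
  have hs0' : 0 < s := hs0
  rw [div_lt_iff₀ hs0'] at hs
  have := le_inducedNorm hQ hC hC0 (1 + s • M) a
  rw [Matrix.add_mulVec, Matrix.one_mulVec, Matrix.smul_mulVec] at this
  refine this.trans (mul_le_mul_of_nonneg_right ?_ (apply_nonneg _ _))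
  linarith

end MatrixMeasure

/-! ### The weighted block norm -/

section StarNorm

variable {n r : ℕ}

theorem div_lt_ceilDiv (hr : 1 ≤ r) (i : Fin n) : (i : ℕ) / r < n ⌈/⌉ r := by
  have h1 : n ≤ r * (n ⌈/⌉ r) := by
    rw [← smul_eq_mul]; exact le_smul_ceilDiv (Nat.lt_of_lt_of_le Nat.zero_lt_one hr)
  exact Nat.div_lt_of_lt_mul (i.2.trans_le h1)

theorem blockNorm_nonneg (r : ℕ) (a : Fin n → ℝ) (k : ℕ) : 0 ≤ blockNorm r a k := norm_nonneg _

theorem abs_le_blockNorm (r : ℕ) (a : Fin n → ℝ) (i : Fin n) :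
    |a i| ≤ blockNorm r a ((i : ℕ) / r) :=
  norm_le_pi_norm (fun j : {j : Fin n // (j : ℕ) / r = (i : ℕ) / r} => a j) ⟨i, rfl⟩

theorem blockNorm_le {a : Fin n → ℝ} {k : ℕ} {B : ℝ} (hB : 0 ≤ B)
    (h : ∀ i : Fin n, (i : ℕ) / r = k → |a i| ≤ B) : blockNorm r a k ≤ B :=
  (pi_norm_le_iff_of_nonneg hB).2 fun i => h i.1 i.2

theorem norm_toLp_le_of_abs_le {m : ℕ} {u v : Fin m → ℝ} (h : ∀ k, |u k| ≤ v k) :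
    ‖WithLp.toLp 2 u‖ ≤ ‖WithLp.toLp 2 v‖ := by
  rw [EuclideanSpace.norm_eq, EuclideanSpace.norm_eq]
  refine Real.sqrt_le_sqrt (Finset.sum_le_sum fun k _ => ?_)
  refine pow_le_pow_left₀ (norm_nonneg _) ?_ 2
  exact (h k).trans (le_abs_self _)

theorem norm_toLp_const_le {m : ℕ} {ρ : ℝ} (hρ : 0 ≤ ρ) :
    ‖WithLp.toLp 2 (fun _ : Fin m => ρ)‖ ≤ m * ρ := by
  rw [EuclideanSpace.norm_eq]
  refine Real.sqrt_le_iff.2 ⟨by positivity, ?_⟩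
  simp only [Real.norm_of_nonneg hρ, Finset.sum_const, Finset.card_univ, Fintype.card_fin,
    nsmul_eq_mul, mul_pow]
  refine mul_le_mul_of_nonneg_right ?_ (sq_nonneg ρ)
  exact_mod_cast Nat.le_self_pow two_ne_zero m

/-- Minkowski's inequality in the Euclidean norm over the blocks; the constant vector `ρ` is bounded
crudely by `m ρ` instead of `√m ρ`. -/
theorem starNorm_le_add {q : Fin (n ⌈/⌉ r) → ℝ} (hq : ∀ k, 0 < q k) {a b : Fin n → ℝ}
    {α ρ : ℝ} (hα : 0 ≤ α) (hρ : 0 ≤ ρ)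
    (h : ∀ k, q k * blockNorm r b k ≤ α * (q k * blockNorm r a k) + ρ) :
    starNorm q b ≤ α * starNorm q a + (n ⌈/⌉ r : ℕ) * ρ := by
  have h1 : starNorm q b ≤ ‖WithLp.toLp 2
      (fun k : Fin (n ⌈/⌉ r) => α * (q k * blockNorm r a k) + ρ)‖ :=
    norm_toLp_le_of_abs_le fun k => by
      rw [abs_of_nonneg (mul_nonneg (hq k).le (blockNorm_nonneg _ _ _))]; exact h k
  have h2 : WithLp.toLp 2 (fun k : Fin (n ⌈/⌉ r) => α * (q k * blockNorm r a k) + ρ)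
      = α • WithLp.toLp 2 (fun k : Fin (n ⌈/⌉ r) => q k * blockNorm r a k)
        + WithLp.toLp 2 (fun _ : Fin (n ⌈/⌉ r) => ρ) := by
    ext k; simp
  rw [h2] at h1
  refine h1.trans ((norm_add_le _ _).trans (add_le_add ?_ (norm_toLp_const_le hρ)))
  rw [norm_smul, Real.norm_of_nonneg hα]
  rfl

theorem mul_blockNorm_le_starNorm {q : Fin (n ⌈/⌉ r) → ℝ} (hq : ∀ k, 0 < q k) (a : Fin n → ℝ)
    (k : Fin (n ⌈/⌉ r)) : q k * blockNorm r a k ≤ starNorm q a := by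
  have := EuclideanSpace.norm_eq (WithLp.toLp 2 (fun k : Fin (n ⌈/⌉ r) => q k * blockNorm r a k))
  rw [starNorm, this]
  refine Real.le_sqrt_of_sq_le ?_
  have h1 := Finset.single_le_sum (s := Finset.univ)
    (f := fun k : Fin (n ⌈/⌉ r) => ‖q k * blockNorm r a k‖ ^ 2)
    (fun i _ => by positivity) (Finset.mem_univ k)
  rwa [Real.norm_of_nonneg (mul_nonneg (hq k).le (blockNorm_nonneg _ _ _))] at h1

/-- The norm `|·|_*` as a seminorm. -/
noncomputable def starSeminorm (q : Fin (n ⌈/⌉ r) → ℝ) (hq : ∀ k, 0 < q k) :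
    Seminorm ℝ (Fin n → ℝ) :=
  Seminorm.of (starNorm q)
    (fun a b => by
      have h1 : starNorm q (a + b) ≤ ‖WithLp.toLp 2
          (fun k : Fin (n ⌈/⌉ r) => q k * blockNorm r a k + q k * blockNorm r b k)‖ :=
        norm_toLp_le_of_abs_le fun k => by
          rw [abs_of_nonneg (mul_nonneg (hq k).le (blockNorm_nonneg _ _ _)), ← mul_add]
          exact mul_le_mul_of_nonneg_left (norm_add_le (fun i : {i : Fin n // (i : ℕ) / r = k} =>
            a i) fun i : {i : Fin n // (i : ℕ) / r = k} => b i) (hq k).le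
      exact h1.trans (norm_add_le (WithLp.toLp 2 fun k : Fin (n ⌈/⌉ r) => q k * blockNorm r a k)
        (WithLp.toLp 2 fun k : Fin (n ⌈/⌉ r) => q k * blockNorm r b k)))
    (fun s a => by
      have h1 : (fun k : Fin (n ⌈/⌉ r) => q k * blockNorm r (s • a) k)
          = ‖s‖ • fun k : Fin (n ⌈/⌉ r) => q k * blockNorm r a k := by
        ext k
        have : blockNorm r (s • a) k = ‖s‖ * blockNorm r a k :=
          norm_smul s (fun i : {i : Fin n // (i : ℕ) / r = k} => a i)
        simp only [this, Pi.smul_apply, smul_eq_mul]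
        ring
      rw [starNorm, h1, WithLp.toLp_smul, norm_smul, norm_norm]
      rfl)

@[simp]
theorem coe_starSeminorm (q : Fin (n ⌈/⌉ r) → ℝ) (hq : ∀ k, 0 < q k) :
    ⇑(starSeminorm q hq) = starNorm q := rfl

theorem exists_norm_le_mul_starNorm (hr : 1 ≤ r) {q : Fin (n ⌈/⌉ r) → ℝ} (hq : ∀ k, 0 < q k) :
    ∃ Q, 0 < Q ∧ ∀ a, ‖a‖ ≤ Q * starNorm q a := by
  have hsum : 0 ≤ ∑ k, (q k)⁻¹ := Finset.sum_nonneg fun k _ => (inv_pos.2 (hq k)).le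
  refine ⟨∑ k, (q k)⁻¹ + 1, by positivity, fun a => ?_⟩
  have hs : 0 ≤ starNorm q a := norm_nonneg _
  refine (pi_norm_le_iff_of_nonneg (by positivity)).2 fun i => ?_
  set k : Fin (n ⌈/⌉ r) := ⟨(i : ℕ) / r, div_lt_ceilDiv hr i⟩
  have h1 : q k * |a i| ≤ starNorm q a :=
    (mul_le_mul_of_nonneg_left (abs_le_blockNorm r a i) (hq k).le).trans
      (mul_blockNorm_le_starNorm hq a k)
  have h2 : (q k)⁻¹ ≤ ∑ k, (q k)⁻¹ :=
    Finset.single_le_sum (f := fun k => (q k)⁻¹) (fun i _ => (inv_pos.2 (hq i)).le)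
      (Finset.mem_univ k)
  calc ‖a i‖ = (q k)⁻¹ * (q k * |a i|) := by
        rw [← mul_assoc, inv_mul_cancel₀ (hq k).ne', one_mul, Real.norm_eq_abs]
    _ ≤ (q k)⁻¹ * starNorm q a := mul_le_mul_of_nonneg_left h1 (inv_pos.2 (hq k)).le
    _ ≤ _ := mul_le_mul_of_nonneg_right (by linarith) hs

theorem exists_starNorm_le_mul_norm {q : Fin (n ⌈/⌉ r) → ℝ} (hq : ∀ k, 0 < q k) :
    ∃ C, 0 < C ∧ ∀ a, starNorm q a ≤ C * ‖a‖ := by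
  refine ⟨‖WithLp.toLp 2 q‖ + 1, by positivity, fun a => ?_⟩
  have h1 : starNorm q a ≤ ‖WithLp.toLp 2 (‖a‖ • q)‖ := norm_toLp_le_of_abs_le fun k => by
    rw [abs_of_nonneg (mul_nonneg (hq k).le (blockNorm_nonneg _ _ _)), Pi.smul_apply,
      smul_eq_mul, mul_comm]
    exact mul_le_mul_of_nonneg_right
      (blockNorm_le (norm_nonneg a) fun i _ => norm_le_pi_norm a i) (hq k).le
  rw [WithLp.toLp_smul, norm_smul, norm_norm] at h1
  nlinarith [norm_nonneg a]

theorem continuous_starSeminorm (q : Fin (n ⌈/⌉ r) → ℝ) (hq : ∀ k, 0 < q k) :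
    Continuous (starSeminorm q hq) := by
  obtain ⟨C, -, hC⟩ := exists_starNorm_le_mul_norm hq
  refine Seminorm.continuous_of_le (q := (C.toNNReal) • normSeminorm ℝ (Fin n → ℝ)) ?_ ?_
  · exact continuous_norm.const_smul C.toNNReal
  · intro a
    refine (hC a).trans ?_
    exact mul_le_mul_of_nonneg_right (Real.le_coe_toNNReal C) (norm_nonneg a)

theorem norm_G_mulVec_le (hr : 1 ≤ r) {q : Fin (n ⌈/⌉ r) → ℝ} (hq : ∀ k, 0 < q k)
    (a : Fin n → ℝ) : ‖(G n).mulVec a‖ ≤ normGInftyStar q * starNorm q a := by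
  obtain ⟨Q, hQ0, hQ⟩ := exists_norm_le_mul_starNorm hr hq
  rcases eq_or_ne a 0 with rfl | ha
  · rw [Matrix.mulVec_zero, norm_zero]
    have : starNorm q (0 : Fin n → ℝ) = 0 := map_zero (starSeminorm q hq)
    rw [this, mul_zero]
  · have hpos : ∀ b : Fin n → ℝ, b ≠ 0 → 0 < starNorm q b := fun b hb => by
      have h1 := (norm_pos_iff.2 hb).trans_le (hQ b)
      exact pos_of_mul_pos_right h1 hQ0.le
    rw [← div_le_iff₀ (hpos a ha)]
    refine le_csSup ⟨‖(Matrix.mulVecLin (G n)).toContinuousLinearMap‖ * Q, ?_⟩ ⟨a, ha, rfl⟩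
    rintro _ ⟨b, hb, rfl⟩
    change _ / _ ≤ _
    rw [div_le_iff₀ (hpos b hb), mul_assoc]
    exact ((Matrix.mulVecLin (G n)).toContinuousLinearMap.le_opNorm b).trans
      (mul_le_mul_of_nonneg_left (hQ b) (norm_nonneg _))

theorem normGInftyStar_nonneg (q : Fin (n ⌈/⌉ r) → ℝ) : 0 ≤ normGInftyStar q :=
  Real.sSup_nonneg (by rintro _ ⟨a, -, rfl⟩; exact div_nonneg (norm_nonneg _) (norm_nonneg _))

end StarNorm

/-! ### Essential suprema of signals -/

section Signal

variable {n : ℕ} {N : (Fin n → ℝ) → ℝ} {w : ℝ → Fin n → ℝ}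

theorem signalNorm_truncate_le (hN0 : N 0 = 0) (t : ℝ) :
    signalNorm N (truncate t w) ≤ signalNorm N w := by
  refine essSup_mono_ae (Eventually.of_forall fun s => ?_)
  by_cases hs : s ∈ Icc 0 t <;> simp [truncate, hs, hN0]

theorem ae_le_toReal_signalNorm {v : ℝ → Fin n → ℝ} (hN : ∀ a, 0 ≤ N a)
    (hv : signalNorm N v ≠ ⊤) :
    ∀ᵐ s ∂volume.restrict (Ici (0 : ℝ)), N (v s) ≤ (signalNorm N v).toReal := by
  filter_upwards [ENNReal.ae_le_essSup (μ := volume.restrict (Ici (0 : ℝ)))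
    fun t => ENNReal.ofReal (N (v t))] with s hs
  have := ENNReal.toReal_mono hv hs
  rwa [ENNReal.toReal_ofReal (hN _)] at this

theorem ae_le_toReal_signalNorm_truncate {t : ℝ} (hN : ∀ a, 0 ≤ N a)
    (hw : signalNorm N (truncate t w) ≠ ⊤) :
    ∀ᵐ s ∂volume.restrict (Icc (0 : ℝ) t), N (w s) ≤ (signalNorm N (truncate t w)).toReal := by
  filter_upwards [ae_restrict_of_ae_restrict_of_subset Icc_subset_Ici_self
    (ae_le_toReal_signalNorm hN hw), ae_restrict_mem measurableSet_Icc] with s hs hst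
  rwa [truncate, indicator_of_mem hst] at hs

end Signal

/-! ### Consequences of the conditions on the partial derivatives -/

section Partials

variable {n : ℕ} {d : Fin n → (Fin n → ℝ) → ℝ}

theorem fderiv_apply_eq_zero (hdiff : ∀ i, Differentiable ℝ (d i))
    (hloc : DependsOnNeighbours d) {i : Fin n} (x : Fin n → ℝ) {v : Fin n → ℝ} (h0 : v i = 0)
    (h1 : ∀ j : Fin n, (j : ℕ) = i + 1 → v j = 0) : fderiv ℝ (d i) x v = 0 := by
  rw [← (hdiff i x).lineDeriv_eq_fderiv, lineDeriv]
  have : (fun t : ℝ => d i (x + t • v)) = fun _ => d i x := by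
    ext t
    exact hloc i _ _ (by simp [h0]) fun j hj => by simp [h1 j hj]
  rw [this, deriv_const]

theorem pderiv_eq (hdiff : ∀ i, Differentiable ℝ (d i)) (hloc : DependsOnNeighbours d)
    (i j : Fin n) (x : Fin n → ℝ) :
    pderiv (d i) j x = (if i = j then pderiv (d i) i x else 0)
      + if (i : ℕ) + 1 = j then pderivNext d i x else 0 := by
  by_cases hij : i = j
  · subst hij; simp
  by_cases hij' : (i : ℕ) + 1 = j
  · have h1 : (i : ℕ) + 1 < n := hij' ▸ j.2
    have h2 : j = ⟨i + 1, h1⟩ := Fin.ext hij'.symm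
    subst h2
    rw [if_neg hij, if_pos rfl, zero_add, pderivNext, dif_pos h1]
  · rw [if_neg hij, if_neg hij', add_zero]
    refine fderiv_apply_eq_zero hdiff hloc x (by simp [hij]) fun k hk => ?_
    have : k ≠ j := fun hkj => hij' (by rw [← hkj, hk])
    simp [this]

theorem fderiv_apply_eq (hdiff : ∀ i, Differentiable ℝ (d i)) (hloc : DependsOnNeighbours d)
    (i : Fin n) (x v : Fin n → ℝ) :
    fderiv ℝ (d i) x v = pderiv (d i) i x * v i
      + pderivNext d i x * (if h : (i : ℕ) + 1 < n then v ⟨i + 1, h⟩ else 0) := by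
  have h1 : v = ∑ j, v j • Pi.single (M := fun _ => ℝ) j 1 := by
    ext k; simp [Finset.sum_apply, Pi.single_apply]
  have h2 : fderiv ℝ (d i) x v = ∑ j, v j * pderiv (d i) j x := by
    conv_lhs => rw [h1]
    simp [pderiv]
  rw [h2]
  rw [Finset.sum_congr rfl fun j _ => congrArg (v j * ·) (pderiv_eq hdiff hloc i j x)]
  simp_rw [mul_add, Finset.sum_add_distrib]
  congr 1
  · simp [mul_comm]
  · by_cases h : (i : ℕ) + 1 < n
    · rw [Finset.sum_eq_single ⟨i + 1, h⟩]
      · simp [h, mul_comm]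
      · intro j _ hj
        rw [if_neg (fun hh => hj (Fin.ext hh.symm)), mul_zero]
      · simp
    · rw [dif_neg h, mul_zero]
      refine Finset.sum_eq_zero fun j _ => ?_
      rw [if_neg (fun (hh : (i : ℕ) + 1 = j) => h (hh ▸ j.2)), mul_zero]

theorem pderivNext_nonpos {η₁ : ℝ} (hsign : SignSumCondition d η₁) (i : Fin n)
    (x : Fin n → ℝ) : pderivNext d i x ≤ 0 := by
  by_cases h : (i : ℕ) + 1 < n
  · exact ((hsign i x).2.1 h).le
  · simp [pderivNext, h]

theorem neg_le_pderivNext {c : ℝ} (hbound : BoundCondition d c) (i : Fin n) (x : Fin n → ℝ) :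
    -c ≤ pderivNext d i x := by
  have := (le_max_right _ _).trans (hbound i x)
  exact (abs_le.1 this).1

theorem pderiv_self_le {c : ℝ} (hbound : BoundCondition d c) (i : Fin n) (x : Fin n → ℝ) :
    pderiv (d i) i x ≤ c :=
  (le_abs_self _).trans ((le_max_left _ _).trans (hbound i x))

/-- Mean value theorem on the segment from `x'` to `x`: both partial derivatives are taken at one
point `ξ`, which may depend on `i`. -/
theorem exists_sub_eq (hdiff : ∀ i, Differentiable ℝ (d i)) (hloc : DependsOnNeighbours d)
    (i : Fin n) (x x' : Fin n → ℝ) :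
    ∃ ξ, d i x - d i x' = pderiv (d i) i ξ * (x - x') i
      + pderivNext d i ξ * (if h : (i : ℕ) + 1 < n then (x - x') ⟨i + 1, h⟩ else 0) := by
  obtain ⟨ξ, -, hξ⟩ := domain_mvt (f := d i) (s := univ) (x := x') (y := x)
    (f' := fun z => fderiv ℝ (d i) z)
    (fun z _ => (hdiff i z).hasFDerivAt.hasFDerivWithinAt) convex_univ trivial trivial
  exact ⟨ξ, by rw [hξ, fderiv_apply_eq hdiff hloc]⟩

theorem abs_dite_le_norm (i : Fin n) (v : Fin n → ℝ) :
    |if h : (i : ℕ) + 1 < n then v ⟨i + 1, h⟩ else 0| ≤ ‖v‖ := by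
  split_ifs with h
  · exact norm_le_pi_norm v _
  · simp

theorem abs_sub_le_mul_norm (hdiff : ∀ i, Differentiable ℝ (d i)) (hloc : DependsOnNeighbours d)
    {c : ℝ} (hbound : BoundCondition d c) (i : Fin n) (x x' : Fin n → ℝ) :
    |d i x - d i x'| ≤ 2 * c * ‖x - x'‖ := by
  obtain ⟨ξ, hξ⟩ := exists_sub_eq hdiff hloc i x x'
  rw [hξ]
  have h1 := (le_max_left _ _).trans (hbound i ξ)
  have h2 := (le_max_right _ _).trans (hbound i ξ)
  have h3 : |(x - x') i| ≤ ‖x - x'‖ := norm_le_pi_norm (x - x') i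
  have h4 := abs_dite_le_norm i (x - x')
  have hc : 0 ≤ c := (abs_nonneg _).trans h1
  refine (abs_add_le _ _).trans ?_
  rw [abs_mul, abs_mul]
  have h5 := mul_le_mul h1 h3 (abs_nonneg _) hc
  have h6 := mul_le_mul h2 h4 (abs_nonneg _) hc
  linarith

theorem norm_f_sub_le (hdiff : ∀ i, Differentiable ℝ (d i)) (hloc : DependsOnNeighbours d)
    {c : ℝ} (hc : 0 ≤ c) (hbound : BoundCondition d c) (x x' : Fin n → ℝ) :
    ‖f d x - f d x'‖ ≤ 2 * c * ‖x - x'‖ := by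
  refine (pi_norm_le_iff_of_nonneg (by positivity)).2 fun i => ?_
  have := abs_sub_le_mul_norm hdiff hloc hbound i x x'
  simp only [f, Pi.sub_apply, Real.norm_eq_abs]
  rwa [neg_sub_neg, abs_sub_comm]

theorem norm_h_sub_le (hdiff : ∀ i, Differentiable ℝ (d i)) (hloc : DependsOnNeighbours d)
    {c : ℝ} (hc : 0 ≤ c) (hbound : BoundCondition d c) (x x' : Fin n → ℝ) :
    ‖h d x - h d x'‖ ≤ n * (2 * c) * ‖x - x'‖ := by
  refine (pi_norm_le_iff_of_nonneg (by positivity)).2 fun i => ?_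
  simp only [h, Pi.sub_apply, Real.norm_eq_abs]
  rw [← Finset.sum_sub_distrib]
  refine (Finset.abs_sum_le_sum_abs _ _).trans ?_
  refine (Finset.sum_le_card_nsmul _ _ _ fun j _ =>
    abs_sub_le_mul_norm hdiff hloc hbound j x x').trans ?_
  rw [nsmul_eq_mul, mul_assoc (n : ℝ)]
  have hcard : (Finset.univ.filter fun j : Fin n => j < i).card ≤ n :=
    (Finset.card_filter_le _ _).trans (by simp)
  exact mul_le_mul_of_nonneg_right (by exact_mod_cast hcard) (by positivity)

/-- For small `τ` each coordinate of the Euler step is a combination of two coordinates of `x - e`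
with nonnegative coefficients, whose sum is at most `1 - τ η₁` by the sign and sum conditions. The
point `ξ` may change from row to row, since the maximum norm treats rows separately. -/
theorem norm_sub_add_smul_f_le (hdiff : ∀ i, Differentiable ℝ (d i))
    (hloc : DependsOnNeighbours d) {η₁ c : ℝ} (hsign : SignSumCondition d η₁)
    (hbound : BoundCondition d c) {e : Fin n → ℝ} (he : ∀ i, d i e = 0) (x : Fin n → ℝ) {τ : ℝ}
    (hτ : 0 ≤ τ) (hτc : τ * c ≤ 1) (hτη : τ * η₁ ≤ 1) :
    ‖(x - e) + τ • f d x‖ ≤ (1 - τ * η₁) * ‖x - e‖ := by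
  refine (pi_norm_le_iff_of_nonneg (mul_nonneg (by linarith) (norm_nonneg _))).2 fun i => ?_
  obtain ⟨ξ, hξ⟩ := exists_sub_eq hdiff hloc i x e
  rw [he, sub_zero] at hξ
  set u := (if h : (i : ℕ) + 1 < n then (x - e) ⟨i + 1, h⟩ else 0) with hu
  have h1 : ((x - e) + τ • f d x) i = (1 - τ * pderiv (d i) i ξ) * (x - e) i
      + τ * -pderivNext d i ξ * u := by
    simp only [f, Pi.add_apply, Pi.smul_apply, smul_eq_mul, hξ]; ring
  have h3 : |(x - e) i| ≤ ‖x - e‖ := norm_le_pi_norm (x - e) i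
  have h4 : |u| ≤ ‖x - e‖ := abs_dite_le_norm i (x - e)
  have h5 : 0 ≤ 1 - τ * pderiv (d i) i ξ := by
    have := mul_le_mul_of_nonneg_left (pderiv_self_le hbound i ξ) hτ
    linarith
  have h6 : 0 ≤ τ * -pderivNext d i ξ :=
    mul_nonneg hτ (neg_nonneg.2 (pderivNext_nonpos hsign i ξ))
  rw [h1, Real.norm_eq_abs]
  refine (abs_add_le _ _).trans ?_
  rw [abs_mul, abs_mul, abs_of_nonneg h5, abs_of_nonneg h6]
  have h7 := mul_le_mul_of_nonneg_left h3 h5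
  have h8 := mul_le_mul_of_nonneg_left h4 h6
  have h9 := mul_le_mul_of_nonneg_left (hsign i ξ).2.2 hτ
  have h10 := mul_le_mul_of_nonneg_right h9 (norm_nonneg (x - e))
  linarith

theorem jacobian_h_apply (hdiff : ∀ i, Differentiable ℝ (d i)) (hloc : DependsOnNeighbours d)
    (x : Fin n → ℝ) (i j : Fin n) :
    jacobian (h d) x i j = (if j < i then pderiv (d j) j x else 0)
      + if j ≤ i then ∑ k : Fin n, (if (k : ℕ) + 1 = j then pderivNext d k x else 0) else 0 := by
  have h1 : jacobian (h d) x i j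
      = ∑ k ∈ Finset.univ.filter (fun k : Fin n => k < i), pderiv (d k) j x := by
    simp only [jacobian, h, Matrix.of_apply, pderiv]
    rw [fderiv_fun_sum fun k _ => hdiff k x, sum_apply]
  rw [h1]
  rw [Finset.sum_congr rfl fun k _ => pderiv_eq hdiff hloc k j x, Finset.sum_add_distrib]
  congr 1
  · rw [Finset.sum_ite_eq']
    simp
  · by_cases hji : j ≤ i
    · rw [if_pos hji, Finset.sum_filter]
      refine Finset.sum_congr rfl fun k _ => ?_
      by_cases hk : (k : ℕ) + 1 = j
      · have : k < i := Fin.lt_def.2 (by have := Fin.le_def.1 hji; omega)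
        simp [this]
      · simp [hk]
    · rw [if_neg hji]
      refine Finset.sum_eq_zero fun k hk => if_neg fun hkj => hji ?_
      have := Fin.lt_def.1 (Finset.mem_filter.1 hk).2
      exact Fin.le_def.2 (by omega)

theorem sum_pderivNext_mem {η₁ c : ℝ} (hc : 0 ≤ c) (hsign : SignSumCondition d η₁)
    (hbound : BoundCondition d c) (x : Fin n → ℝ) (j : ℕ) :
    (∑ k : Fin n, (if (k : ℕ) + 1 = j then pderivNext d k x else 0)) ∈ Icc (-c) 0 := by
  by_cases hj : ∃ k : Fin n, (k : ℕ) + 1 = j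
  · obtain ⟨k, rfl⟩ := hj
    rw [Finset.sum_eq_single k]
    · rw [if_pos rfl]
      exact ⟨neg_le_pderivNext hbound k x, pderivNext_nonpos hsign k x⟩
    · intro l _ hl
      exact if_neg fun hh => hl (Fin.ext (by omega))
    · simp
  · rw [Finset.sum_eq_zero fun k _ => if_neg fun hh => hj ⟨k, hh⟩]
    exact ⟨by linarith, le_rfl⟩

/-- The entry is a number in `[0, c]` plus one in `[-c, 0]`, so the bound is `c` and not `2 * c`. -/
theorem abs_jacobian_h_le (hdiff : ∀ i, Differentiable ℝ (d i)) (hloc : DependsOnNeighbours d)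
    {η₁ c : ℝ} (hc : 0 ≤ c) (hsign : SignSumCondition d η₁) (hbound : BoundCondition d c)
    (x : Fin n → ℝ) (i j : Fin n) : |jacobian (h d) x i j| ≤ c := by
  have h1 := sum_pderivNext_mem hc hsign hbound x j
  have h2 := pderiv_self_le hbound j x
  have h3 := (hsign j x).1
  rw [jacobian_h_apply hdiff hloc, abs_le]
  split_ifs <;> constructor <;> linarith [h1.1, h1.2]

theorem norm_jacobian_h_mulVec_le (hdiff : ∀ i, Differentiable ℝ (d i))
    (hloc : DependsOnNeighbours d) {η₁ c : ℝ} (hc : 0 ≤ c) (hsign : SignSumCondition d η₁)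
    (hbound : BoundCondition d c) (x v : Fin n → ℝ) :
    ‖(jacobian (h d) x).mulVec v‖ ≤ n * c * ‖v‖ := by
  refine (pi_norm_le_iff_of_nonneg (by positivity)).2 fun i => ?_
  rw [Matrix.mulVec, dotProduct, Real.norm_eq_abs]
  refine (Finset.abs_sum_le_sum_abs _ _).trans ?_
  refine (Finset.sum_le_card_nsmul _ _ (c * ‖v‖) fun j _ => ?_).trans ?_
  · rw [abs_mul]
    exact mul_le_mul (abs_jacobian_h_le hdiff hloc hc hsign hbound x i j) (norm_le_pi_norm v j)
      (abs_nonneg _) hc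
  · simp [mul_assoc]

theorem mul_G_apply (M : Matrix (Fin n) (Fin n) ℝ) (i j : Fin n) :
    (M * G n) i j = -M i j + if h : (j : ℕ) + 1 < n then M i ⟨j + 1, h⟩ else 0 := by
  have h1 : ∀ l : Fin n, M i l * G n l j
      = (if l = j then -M i l else 0) + if (l : ℕ) = j + 1 then M i l else 0 := fun l => by
    simp only [G, Matrix.of_apply]
    by_cases hl : l = j
    · subst hl; simp
    · by_cases hl' : (l : ℕ) = j + 1 <;> simp [hl, hl']
  rw [Matrix.mul_apply]
  simp_rw [h1, Finset.sum_add_distrib]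
  congr 1
  · simp
  · split_ifs with h
    · rw [Finset.sum_eq_single ⟨j + 1, h⟩]
      · simp
      · intro l _ hl
        exact if_neg fun hh => hl (Fin.ext hh)
      · simp
    · exact Finset.sum_eq_zero fun l _ => if_neg fun (hh : (l : ℕ) = j + 1) => h (hh ▸ l.2)

/-- Right multiplication by `G` replaces column `j` by column `j + 1` minus column `j`. Below the
diagonal this is a difference of two numbers in `[-c, c]`; on the diagonal only `-∂d_{i-1}/∂x_i`
survives, and its sign helps the contraction. -/
theorem jacobian_h_mul_G_bounds (hdiff : ∀ i, Differentiable ℝ (d i))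
    (hloc : DependsOnNeighbours d) {η₁ c : ℝ} (hc : 0 ≤ c) (hsign : SignSumCondition d η₁)
    (hbound : BoundCondition d c) (x : Fin n → ℝ) (i j : Fin n) :
    (i < j → (jacobian (h d) x * G n) i j = 0) ∧
    (j < i → |(jacobian (h d) x * G n) i j| ≤ 2 * c) ∧
    (jacobian (h d) x * G n) i i ∈ Icc 0 c := by
  refine ⟨fun hij => ?_, fun hji => ?_, ?_⟩
  · have h1 : ¬ j < i := not_lt.2 hij.le
    have h2 : ¬ j ≤ i := not_le.2 hij
    rw [mul_G_apply]
    have h3 : ∀ hj : (j : ℕ) + 1 < n, jacobian (h d) x i ⟨j + 1, hj⟩ = 0 := fun hj => by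
      have h4 := Fin.lt_def.1 hij
      rw [jacobian_h_apply hdiff hloc, if_neg (by rw [Fin.lt_def]; simp; omega),
        if_neg (by rw [Fin.le_def]; simp; omega), add_zero]
    rw [jacobian_h_apply hdiff hloc, if_neg h1, if_neg h2]
    split_ifs with hj
    · rw [h3 hj]; simp
    · simp
  · have hji' := Fin.lt_def.1 hji
    have hj : (j : ℕ) + 1 < n := by omega
    rw [mul_G_apply, dif_pos hj, jacobian_h_apply hdiff hloc, jacobian_h_apply hdiff hloc,
      if_pos hji, if_pos hji.le]
    have h1 := sum_pderivNext_mem hc hsign hbound x j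
    have h2 := sum_pderivNext_mem hc hsign hbound x ((⟨j + 1, hj⟩ : Fin n) : ℕ)
    have h3 := pderiv_self_le hbound j x
    have h4 := (hsign j x).1
    have h5 := pderiv_self_le hbound ⟨j + 1, hj⟩ x
    have h6 := (hsign ⟨j + 1, hj⟩ x).1
    rw [abs_le]
    split_ifs <;> constructor <;> linarith [h1.1, h1.2, h2.1, h2.2]
  · rw [mul_G_apply, jacobian_h_apply hdiff hloc, if_neg (lt_irrefl i), if_pos le_rfl]
    have h1 := sum_pderivNext_mem hc hsign hbound x i
    have h3 : ∀ hi : (i : ℕ) + 1 < n, jacobian (h d) x i ⟨i + 1, hi⟩ = 0 := fun hi => by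
      rw [jacobian_h_apply hdiff hloc, if_neg (by rw [Fin.lt_def]; simp),
        if_neg (by rw [Fin.le_def]; simp), add_zero]
    split_ifs with hi
    · rw [h3 hi]; constructor <;> linarith [h1.1, h1.2]
    · constructor <;> linarith [h1.1, h1.2]

end Partials

/-! ### Contraction of lower triangular matrices in the block norm -/

section BlockTriangular

variable {n r : ℕ}

theorem card_lt_sameBlock_le (hr : 1 ≤ r) (i : Fin n) :
    (Finset.univ.filter fun j : Fin n => j < i ∧ (j : ℕ) / r = (i : ℕ) / r).card ≤ r - 1 := by
  have h1 : ((Finset.univ.filter fun j : Fin n => j < i ∧ (j : ℕ) / r = (i : ℕ) / r).map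
      Fin.valEmbedding) ⊆ Finset.Ico (r * ((i : ℕ) / r)) i := by
    intro k hk
    obtain ⟨j, hj, rfl⟩ := Finset.mem_map.1 hk
    have h2 := (Finset.mem_filter.1 hj).2
    refine Finset.mem_Ico.2 ⟨?_, h2.1⟩
    rw [← h2.2]
    exact Nat.mul_div_le _ _
  have h2 := Finset.card_le_card h1
  rw [Finset.card_map, Nat.card_Ico] at h2
  have h3 := Nat.div_add_mod (i : ℕ) r
  have h4 := Nat.mod_lt (i : ℕ) hr
  omega

/-- Row sum estimate for `I + s J`: at most `r - 1` entries of size `β` lie in the same block to the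
left of the diagonal, and all other off-diagonal terms come from earlier blocks. -/
theorem blockNorm_add_smul_mulVec_le (hr : 1 ≤ r) {J : Matrix (Fin n) (Fin n) ℝ}
    {β L K γ : ℝ} (hβ : 0 ≤ β) (hL : 0 ≤ L) (hupper : ∀ i j, i < j → J i j = 0)
    (hsame : ∀ i j : Fin n, j < i → (j : ℕ) / r = (i : ℕ) / r → |J i j| ≤ β)
    (hlower : ∀ i j : Fin n, j < i → |J i j| ≤ L) (hdiag : ∀ i, -K ≤ J i i)
    (hdiag' : ∀ i, J i i + β * ((r : ℝ) - 1) ≤ -γ) {s : ℝ} (hs : 0 ≤ s) (hsK : s * K ≤ 1)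
    (hsγ : s * γ ≤ 1) (a : Fin n → ℝ) (k : ℕ) :
    blockNorm r (a + s • J.mulVec a) k ≤ (1 - s * γ) * blockNorm r a k
      + s * L * ∑ j : Fin n, if (j : ℕ) / r < k then blockNorm r a ((j : ℕ) / r) else 0 := by
  have hS : 0 ≤ ∑ j : Fin n, if (j : ℕ) / r < k then blockNorm r a ((j : ℕ) / r) else 0 :=
    Finset.sum_nonneg fun j _ => by split_ifs; exacts [blockNorm_nonneg _ _ _, le_rfl]
  refine blockNorm_le (add_nonneg (mul_nonneg (by linarith) (blockNorm_nonneg _ _ _))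
    (by positivity)) fun i hi => ?_
  subst hi
  set b := blockNorm r a ((i : ℕ) / r) with hb
  have hb0 : 0 ≤ b := blockNorm_nonneg _ _ _
  have hterm : ∀ j ∈ Finset.univ.erase i, |J i j * a j|
      ≤ (if j < i ∧ (j : ℕ) / r = (i : ℕ) / r then β * b else 0)
        + L * if (j : ℕ) / r < (i : ℕ) / r then blockNorm r a ((j : ℕ) / r) else 0 := by
    intro j hj
    have hji : j ≠ i := Finset.ne_of_mem_erase hj
    have haj := abs_le_blockNorm r a j
    rcases lt_or_gt_of_ne hji with hlt | hgt
    · rcases (Nat.div_le_div_right (c := r) (Fin.lt_def.1 hlt).le).eq_or_lt with heq | hlt'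
      · rw [if_pos ⟨hlt, heq⟩, if_neg (by omega), mul_zero, add_zero, abs_mul]
        rw [heq] at haj
        exact mul_le_mul (hsame i j hlt heq) haj (abs_nonneg _) hβ
      · rw [if_neg (by omega), if_pos hlt', zero_add, abs_mul]
        exact mul_le_mul (hlower i j hlt) haj (abs_nonneg _) hL
    · rw [hupper i j hgt, zero_mul, abs_zero]
      refine add_nonneg ?_ (mul_nonneg hL ?_)
      · split_ifs; exacts [mul_nonneg hβ hb0, le_rfl]
      · split_ifs; exacts [blockNorm_nonneg _ _ _, le_rfl]
  have hsum : |∑ j ∈ Finset.univ.erase i, J i j * a j| ≤ ((r : ℝ) - 1) * (β * b)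
      + L * ∑ j : Fin n, if (j : ℕ) / r < (i : ℕ) / r then blockNorm r a ((j : ℕ) / r)
        else 0 := by
    refine (Finset.abs_sum_le_sum_abs _ _).trans ((Finset.sum_le_sum hterm).trans ?_)
    rw [Finset.sum_add_distrib, ← Finset.mul_sum]
    refine add_le_add ?_ (mul_le_mul_of_nonneg_left ?_ hL)
    · rw [← Finset.sum_filter, Finset.sum_const, nsmul_eq_mul]
      refine mul_le_mul_of_nonneg_right ?_ (mul_nonneg hβ hb0)
      have h1 : (Finset.filter (fun j : Fin n => j < i ∧ (j : ℕ) / r = (i : ℕ) / r)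
          (Finset.univ.erase i)).card ≤ r - 1 :=
        (Finset.card_le_card (Finset.filter_subset_filter _ (Finset.erase_subset _ _))).trans
          (card_lt_sameBlock_le hr i)
      calc ((Finset.filter (fun j : Fin n => j < i ∧ (j : ℕ) / r = (i : ℕ) / r)
          (Finset.univ.erase i)).card : ℝ) ≤ ((r - 1 : ℕ) : ℝ) := by exact_mod_cast h1
        _ = (r : ℝ) - 1 := by push_cast [hr]; ring
    · refine Finset.sum_le_sum_of_subset_of_nonneg (Finset.erase_subset _ _) fun j _ _ => ?_
      split_ifs; exacts [blockNorm_nonneg _ _ _, le_rfl]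
  have heq : (a + s • J.mulVec a) i
      = (1 + s * J i i) * a i + s * ∑ j ∈ Finset.univ.erase i, J i j * a j := by
    have h1 : J.mulVec a i = J i i * a i + ∑ j ∈ Finset.univ.erase i, J i j * a j := by
      rw [Matrix.mulVec, dotProduct]
      exact (Finset.add_sum_erase _ _ (Finset.mem_univ i)).symm
    rw [Pi.add_apply, Pi.smul_apply, smul_eq_mul, h1]; ring
  have hd0 : 0 ≤ 1 + s * J i i := by
    have := mul_le_mul_of_nonneg_left (hdiag i) hs
    linarith
  rw [heq]
  refine (abs_add_le _ _).trans ?_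
  rw [abs_mul, abs_mul, abs_of_nonneg hd0, abs_of_nonneg hs]
  have h1 := mul_le_mul_of_nonneg_left (abs_le_blockNorm r a i) hd0
  have h2 := mul_le_mul_of_nonneg_left hsum hs
  have h3 := mul_le_mul_of_nonneg_right (mul_le_mul_of_nonneg_left (hdiag' i) hs) hb0
  rw [← hb] at h1
  linarith

/-- In block `k` the weight satisfies `θ ^ k ≤ θ * θ ^ l` for every earlier block `l < k`, so the
whole coupling carries a factor `θ`. -/
theorem starNorm_add_smul_mulVec_le (hr : 1 ≤ r) {J : Matrix (Fin n) (Fin n) ℝ}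
    {β L K γ θ : ℝ} (hβ : 0 ≤ β) (hL : 0 ≤ L) (hupper : ∀ i j, i < j → J i j = 0)
    (hsame : ∀ i j : Fin n, j < i → (j : ℕ) / r = (i : ℕ) / r → |J i j| ≤ β)
    (hlower : ∀ i j : Fin n, j < i → |J i j| ≤ L) (hdiag : ∀ i, -K ≤ J i i)
    (hdiag' : ∀ i, J i i + β * ((r : ℝ) - 1) ≤ -γ) {s : ℝ} (hs : 0 ≤ s) (hsK : s * K ≤ 1)
    (hsγ : s * γ ≤ 1) (hθ : 0 < θ) (hθ1 : θ ≤ 1) (a : Fin n → ℝ) :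
    starNorm (n := n) (r := r) (fun k => θ ^ (k : ℕ)) (a + s • J.mulVec a)
      ≤ (1 - s * (γ - (n ⌈/⌉ r : ℕ) * (L * n * θ)))
        * starNorm (n := n) (r := r) (fun k => θ ^ (k : ℕ)) a := by
  set q : Fin (n ⌈/⌉ r) → ℝ := fun k => θ ^ (k : ℕ) with hqdef
  have hq : ∀ k, 0 < q k := fun k => pow_pos hθ _
  have hN : 0 ≤ starNorm q a := norm_nonneg _
  have key := starNorm_le_add hq (a := a) (b := a + s • J.mulVec a) (α := 1 - s * γ)
    (ρ := s * L * (n * (θ * starNorm q a))) (by linarith) (by positivity) (fun k => by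
    have h1 := mul_le_mul_of_nonneg_left (blockNorm_add_smul_mulVec_le hr hβ hL hupper hsame
      hlower hdiag hdiag' hs hsK hsγ a k) (hq k).le
    have h2 : q k * (∑ j : Fin n, if (j : ℕ) / r < k then blockNorm r a ((j : ℕ) / r) else 0)
        ≤ n * (θ * starNorm q a) := by
      rw [Finset.mul_sum]
      refine (Finset.sum_le_card_nsmul _ _ (θ * starNorm q a) fun j _ => ?_).trans (by simp)
      split_ifs with hj
      · have h3 : q k ≤ θ * θ ^ ((j : ℕ) / r) := by
          rw [← pow_succ']
          exact pow_le_pow_of_le_one hθ.le hθ1 hj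
        refine (mul_le_mul_of_nonneg_right h3 (blockNorm_nonneg _ _ _)).trans ?_
        rw [mul_assoc]
        exact mul_le_mul_of_nonneg_left
          (mul_blockNorm_le_starNorm hq a ⟨(j : ℕ) / r, div_lt_ceilDiv hr j⟩) hθ.le
      · rw [mul_zero]; positivity
    have h4 := mul_le_mul_of_nonneg_left h2 (mul_nonneg hs hL)
    linarith)
  refine key.trans (le_of_eq ?_)
  ring

end BlockTriangular

/-! ### Choice of the weights and of the contraction rate -/

theorem exists_isContractionPair {n r : ℕ} (hr : 1 ≤ r) (hrn : r ≤ n)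
    {d : Fin n → (Fin n → ℝ) → ℝ} (hdiff : ∀ i, Differentiable ℝ (d i))
    (hloc : DependsOnNeighbours d) {η₁ c : ℝ} (hc : 0 < c) (hsign : SignSumCondition d η₁)
    (hbound : BoundCondition d c) {kbar : Fin n → ℝ} {εbar : ℝ} (hεbar : 0 < εbar)
    (hkbar : ∀ i, -kbar i + 2 * εbar * c * ((r : ℝ) - 1) < 0) :
    ∃ (q : Fin (n ⌈/⌉ r) → ℝ) (η₂ : ℝ), IsContractionPair d r kbar εbar q η₂ := by
  have hn : 0 < n := by omega
  have : Nonempty (Fin n) := ⟨⟨0, hn⟩⟩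
  -- `γ` is the smallest margin in the gain condition; half of it will pay for the coupling between
  -- blocks.
  obtain ⟨i₀, hi₀⟩ := Finite.exists_max fun i => -kbar i + 2 * εbar * c * ((r : ℝ) - 1)
  set γ := -(-kbar i₀ + 2 * εbar * c * ((r : ℝ) - 1)) with hγ
  have hγ0 : 0 < γ := by rw [hγ]; linarith [hkbar i₀]
  have hr1 : (0 : ℝ) ≤ (r : ℝ) - 1 := by
    rw [sub_nonneg]; exact_mod_cast hr
  have hkpos : ∀ i, 0 < kbar i := fun i => by
    have h1 : 0 ≤ 2 * εbar * c * ((r : ℝ) - 1) := by positivity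
    linarith [hkbar i]
  obtain ⟨i₁, hi₁⟩ := Finite.exists_max kbar
  set L := kbar i₁ + 2 * εbar * c with hLdef
  have hL : 0 < L := add_pos (hkpos i₁) (by positivity)
  set E : ℝ := (n ⌈/⌉ r : ℕ) * (L * n) with hE
  have hE0 : 0 ≤ E := by positivity
  set θ := min 1 (γ / (2 * (E + 1))) with hθ
  have hθ0 : 0 < θ := lt_min one_pos (by positivity)
  have hEθ : E * θ ≤ γ / 2 := by
    have h1 : (E + 1) * θ ≤ (E + 1) * (γ / (2 * (E + 1))) :=
      mul_le_mul_of_nonneg_left (min_le_right _ _) (by positivity)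
    have h2 : (E + 1) * (γ / (2 * (E + 1))) = γ / 2 := by field_simp
    linarith
  have hq : ∀ k : Fin (n ⌈/⌉ r), 0 < θ ^ (k : ℕ) := fun k => pow_pos hθ0 _
  refine ⟨fun k => θ ^ (k : ℕ), γ / 2, hq, half_pos hγ0, fun ε hε x => ?_⟩
  obtain ⟨Q, -, hQ⟩ := exists_norm_le_mul_starNorm hr hq
  obtain ⟨C, hC0, hC⟩ := exists_starNorm_le_mul_norm hq
  refine matrixMeasure_le (N := starSeminorm _ hq) hn hQ hC hC0.le ?_
  have hP := jacobian_h_mul_G_bounds hdiff hloc hc.le hsign hbound x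
  have hJ : ∀ i j, Jbar d r kbar ε x i j
      = (if i = j then -kbar i else if (i : ℕ) = j + r then kbar i else 0)
        - ε * (jacobian (h d) x * G n) i j := fun i j => rfl
  have hεP : ∀ i j, j < i → |ε * (jacobian (h d) x * G n) i j| ≤ 2 * εbar * c := by
    intro i j hji
    rw [abs_mul, abs_of_pos hε.1]
    calc ε * |(jacobian (h d) x * G n) i j| ≤ εbar * (2 * c) :=
          mul_le_mul hε.2 ((hP i j).2.1 hji) (abs_nonneg _) hεbar.le
      _ = _ := by ring
  filter_upwards [Ioc_mem_nhdsGT (show (0 : ℝ) < min (1 / L) (1 / γ) by positivity)] with s hs a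
  have hs1 : s * L ≤ 1 := by
    rw [← le_div_iff₀ hL]; exact hs.2.trans (min_le_left _ _)
  have hs2 : s * γ ≤ 1 := by
    rw [← le_div_iff₀ hγ0]; exact hs.2.trans (min_le_right _ _)
  refine (starNorm_add_smul_mulVec_le hr (β := 2 * εbar * c) (L := L) (K := L) (γ := γ)
    (by positivity) hL.le ?_ ?_ ?_ ?_ ?_ hs.1.le hs1 hs2 hθ0 (min_le_left _ _) a).trans ?_
  · intro i j hij
    have := Fin.lt_def.1 hij
    rw [hJ, (hP i j).1 hij, if_neg hij.ne, if_neg (by omega)]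
    simp
  · intro i j hji hblock
    -- Positions `r` apart lie in consecutive blocks, so no entry `k̄_i` occurs off the diagonal of
    -- a diagonal block.
    have h1 : ¬ (i : ℕ) = j + r := fun hij => by
      rw [hij, Nat.add_div_right _ hr] at hblock
      omega
    rw [hJ, if_neg hji.ne', if_neg h1, zero_sub, abs_neg]
    exact hεP i j hji
  · intro i j hji
    rw [hJ, if_neg hji.ne']
    refine (abs_sub _ _).trans (add_le_add ?_ (hεP i j hji))
    split_ifs
    · rw [abs_of_pos (hkpos i)]; exact hi₁ i
    · rw [abs_zero]; exact (hkpos i₁).le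
  · intro i
    rw [hJ, if_pos rfl]
    have h1 : ε * (jacobian (h d) x * G n) i i ≤ εbar * c :=
      mul_le_mul hε.2 (hP i i).2.2.2 (hP i i).2.2.1 hεbar.le
    have h2 : 0 < εbar * c := by positivity
    linarith [hi₁ i]
  · intro i
    rw [hJ, if_pos rfl]
    have h1 : 0 ≤ ε * (jacobian (h d) x * G n) i i := mul_nonneg hε.1.le (hP i i).2.2.1
    linarith [hi₀ i]
  · refine mul_le_mul_of_nonneg_right ?_ (norm_nonneg _)
    have h1 : (n ⌈/⌉ r : ℕ) * (L * n * θ) = E * θ := by rw [hE]; ring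
    rw [h1]
    have := mul_le_mul_of_nonneg_left hEθ hs.1.le
    linarith

/-! ### Differential inequalities for the slow and the fast variable -/

section Estimates

variable {n r : ℕ} {d : Fin n → (Fin n → ℝ) → ℝ} {kbar : Fin n → ℝ} {ε T : ℝ}
  {w x y : ℝ → Fin n → ℝ}

theorem contDiff_h (hd : ∀ i, ContDiff ℝ 1 (d i)) : ContDiff ℝ 1 (h d) :=
  contDiff_pi.2 fun _ => ContDiff.sum fun j _ => hd j

theorem continuous_f (hd : ∀ i, ContDiff ℝ 1 (d i)) : Continuous (f d) :=
  continuous_pi fun i => (hd i).continuous.neg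

theorem continuous_jacobian_h (hd : ∀ i, ContDiff ℝ 1 (d i)) : Continuous (jacobian (h d)) := by
  refine continuous_matrix fun i j => ?_
  have h1 : ContDiff ℝ 1 fun x => h d x i := contDiff_pi.1 (contDiff_h hd) i
  exact (h1.continuous_fderiv one_ne_zero).clm_apply continuous_const

theorem continuous_fast_field (hd : ∀ i, ContDiff ℝ 1 (d i)) (r : ℕ) (kbar : Fin n → ℝ)
    (ε : ℝ) : Continuous fun p : (Fin n → ℝ) × (Fin n → ℝ) => ε⁻¹ • ((A r kbar).mulVec p.2
      - ε • (jacobian (h d) p.1).mulVec (f d p.1 + (G n).mulVec p.2)) := by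
  have h1 : Continuous fun p : (Fin n → ℝ) × (Fin n → ℝ) => jacobian (h d) p.1 :=
    (continuous_jacobian_h hd).comp continuous_fst
  have h2 : Continuous fun p : (Fin n → ℝ) × (Fin n → ℝ) => f d p.1 + (G n).mulVec p.2 :=
    ((continuous_f hd).comp continuous_fst).add
      (continuous_const.matrix_mulVec continuous_snd)
  exact (((continuous_const.matrix_mulVec continuous_snd)).sub
    ((h1.matrix_mulVec h2).const_smul ε)).const_smul ε⁻¹

theorem IsSolutionOn.mono (hsol : IsSolutionOn d r kbar ε w T x y) {t : ℝ} (ht : t ∈ Icc 0 T) :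
    IsSolutionOn d r kbar ε w t x y where
  integrable_input := hsol.integrable_input.mono_set (by
    rw [uIcc_of_le ht.1, uIcc_of_le (ht.1.trans ht.2)]; exact Icc_subset_Icc le_rfl ht.2)
  continuousOn_x := hsol.continuousOn_x.mono (Icc_subset_Icc le_rfl ht.2)
  continuousOn_y := hsol.continuousOn_y.mono (Icc_subset_Icc le_rfl ht.2)
  eq_x := fun s hs => hsol.eq_x s ⟨hs.1, hs.2.trans ht.2⟩
  eq_y := fun s hs => hsol.eq_y s ⟨hs.1, hs.2.trans ht.2⟩

theorem IsSolutionOn.upperDiniLE_slow (hsol : IsSolutionOn d r kbar ε w T x y)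
    (hd : ∀ i, ContDiff ℝ 1 (d i)) (hloc : DependsOnNeighbours d) {η₁ c : ℝ} (hc : 0 < c)
    (hη₁ : 0 < η₁) (hsign : SignSumCondition d η₁) (hbound : BoundCondition d c)
    {e : Fin n → ℝ} (he : ∀ i, d i e = 0) {N : Seminorm ℝ (Fin n → ℝ)} {g : ℝ}
    (hg : ∀ a, ‖(G n).mulVec a‖ ≤ g * N a) {s : ℝ} (hs : s ∈ Ico 0 T) :
    UpperDiniLE (fun t => ‖x t - e‖) s (-η₁ * ‖x s - e‖ + g * N (y s)) := by
  have hcont : Continuous fun p : (Fin n → ℝ) × (Fin n → ℝ) => f d p.1 + (G n).mulVec p.2 :=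
    ((continuous_f hd).comp continuous_fst).add
      (continuous_const.matrix_mulVec continuous_snd)
  have hm : ContinuousOn (fun u => f d (x u) + (G n).mulVec (y u)) (Icc 0 T) :=
    hcont.comp_continuousOn (hsol.continuousOn_x.prodMk hsol.continuousOn_y)
  have key := upperDiniLE_seminorm (normSeminorm ℝ (Fin n → ℝ)) continuous_norm
    (y := fun t => x t - e) (m := fun u => f d (x u) + (G n).mulVec (y u)) (p := fun _ => 0)
    (B := 0) (L := -η₁ * ‖x s - e‖ + g * N (y s)) hm intervalIntegrable_const
    (Eventually.of_forall fun _ => by simp)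
    (fun t ht => by
      simp only [add_zero]
      rw [hsol.eq_x t ht]; abel) hs ?_
  · rw [add_zero] at key
    exact key
  intro ρ hρ
  filter_upwards [Ioc_mem_nhdsGT (show (0 : ℝ) < min (1 / c) (1 / η₁) by positivity)] with τ hτ
  have hτ1 : τ * c ≤ 1 := by
    rw [← le_div_iff₀ hc]; exact hτ.2.trans (min_le_left _ _)
  have hτ2 : τ * η₁ ≤ 1 := by
    rw [← le_div_iff₀ hη₁]; exact hτ.2.trans (min_le_right _ _)
  have h1 := norm_sub_add_smul_f_le (fun i => (hd i).differentiable one_ne_zero) hloc hsign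
    hbound he (x s) hτ.1.le hτ1 hτ2
  have h2 := mul_le_mul_of_nonneg_left (hg (y s)) hτ.1.le
  have h3 := mul_le_mul_of_nonneg_left hρ.le hτ.1.le
  calc ‖x s - e + τ • (f d (x s) + (G n).mulVec (y s))‖
      = ‖((x s - e) + τ • f d (x s)) + τ • (G n).mulVec (y s)‖ := by rw [smul_add, add_assoc]
    _ ≤ ‖(x s - e) + τ • f d (x s)‖ + τ * ‖(G n).mulVec (y s)‖ := by
        refine (norm_add_le _ _).trans ?_
        rw [norm_smul, Real.norm_of_nonneg hτ.1.le]
    _ ≤ ‖x s - e‖ + τ * ρ := by linarith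

/-- Isolates the part linear in `y`, of size `1/ε` and governed by `J̄`, from a drift in which `ε`
cancels. -/
theorem fast_field_eq (hε : ε ≠ 0) (x y : Fin n → ℝ) :
    ε⁻¹ • ((A r kbar).mulVec y - ε • (jacobian (h d) x).mulVec (f d x + (G n).mulVec y))
      = ε⁻¹ • (Jbar d r kbar ε x).mulVec y - (jacobian (h d) x).mulVec (f d x) := by
  rw [Jbar, Matrix.sub_mulVec, Matrix.smul_mulVec, ← Matrix.mulVec_mulVec, Matrix.mulVec_add]
  generalize (A r kbar).mulVec y = a
  generalize (jacobian (h d) x).mulVec (f d x) = p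
  generalize (jacobian (h d) x).mulVec ((G n).mulVec y) = q
  rw [smul_sub, smul_sub, inv_smul_smul₀ hε (p + q), inv_smul_smul₀ hε q]
  abel

theorem IsSolutionOn.upperDiniLE_fast (hsol : IsSolutionOn d r kbar ε w T x y)
    (hn : 0 < n) (hε : 0 < ε) (hd : ∀ i, ContDiff ℝ 1 (d i)) {N : Seminorm ℝ (Fin n → ℝ)}
    (hN : Continuous N) {Q C : ℝ} (hQ : ∀ a, ‖a‖ ≤ Q * N a) (hC : ∀ a, N a ≤ C * ‖a‖)
    (hC0 : 0 ≤ C) {η₂ ω : ℝ} (hμ : ∀ x, matrixMeasure N (Jbar d r kbar ε x) ≤ -η₂)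
    (hw : ∀ᵐ s ∂volume.restrict (Icc 0 T), N (w s) ≤ ω) {s : ℝ} (hs : s ∈ Ico 0 T) :
    UpperDiniLE (fun t => N (y t)) s
      (-(η₂ / ε) * N (y s) + N ((jacobian (h d) (x s)).mulVec (f d (x s))) + ω) := by
  set m : ℝ → Fin n → ℝ := fun u => ε⁻¹ • ((A r kbar).mulVec (y u)
    - ε • (jacobian (h d) (x u)).mulVec (f d (x u) + (G n).mulVec (y u))) with hm
  have hmc : ContinuousOn m (Icc 0 T) := by
    have := (continuous_fast_field hd r kbar ε).comp_continuousOn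
      (hsol.continuousOn_x.prodMk hsol.continuousOn_y)
    simpa only [hm, Function.comp_def] using this
  refine upperDiniLE_seminorm N hN hmc hsol.integrable_input hw (fun t ht => ?_) hs ?_
  · rw [hsol.eq_y t ht]
    congr 1
    refine intervalIntegral.integral_congr fun u _ => ?_
    simp only [hm]
    rw [smul_add, inv_smul_smul₀ hε.ne']
  intro ρ hρ
  set H := N ((jacobian (h d) (x s)).mulVec (f d (x s))) with hH
  have hNy : 0 ≤ N (y s) := apply_nonneg _ _
  set κ := (ρ - (-(η₂ / ε) * N (y s) + H)) / (N (y s) + 1) with hκ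
  have hκ0 : 0 < κ := div_pos (sub_pos.2 hρ) (by linarith)
  have hκ1 : κ * (N (y s) + 1) = ρ - (-(η₂ / ε) * N (y s) + H) :=
    div_mul_cancel₀ _ (by linarith)
  have h1 := eventually_le_of_matrixMeasure_le hn hQ hC hC0 (hμ (x s))
    (show -η₂ < -η₂ + ε * κ by linarith [mul_pos hε hκ0])
  -- A step `τ` in time `t` is a step `τ/ε` in the fast time, in which the rate of `J̄` is `η₂`.
  have h2 : Tendsto (fun τ : ℝ => τ * ε⁻¹) (𝓝[>] 0) (𝓝[>] 0) := by
    refine tendsto_nhdsWithin_iff.2 ⟨?_, ?_⟩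
    · have : Tendsto (fun τ : ℝ => τ * ε⁻¹) (𝓝 0) (𝓝 (0 * ε⁻¹)) :=
        (continuous_id.mul continuous_const).tendsto 0
      rw [zero_mul] at this
      exact this.mono_left nhdsWithin_le_nhds
    · filter_upwards [self_mem_nhdsWithin] with τ hτ
      exact mul_pos (mem_Ioi.1 hτ) (inv_pos.2 hε)
  filter_upwards [h2.eventually h1, self_mem_nhdsWithin] with τ h3 hτ
  have hτ0 : 0 < τ := hτ
  have h4 : y s + τ • m s = (y s + (τ * ε⁻¹) • (Jbar d r kbar ε (x s)).mulVec (y s))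
      + (-τ) • (jacobian (h d) (x s)).mulVec (f d (x s)) := by
    simp only [hm]
    rw [fast_field_eq hε.ne', smul_sub, smul_smul, neg_smul]
    abel
  have h5 : N ((-τ) • (jacobian (h d) (x s)).mulVec (f d (x s))) = τ * H := by
    rw [map_smul_eq_mul, norm_neg, Real.norm_of_nonneg hτ0.le]
  have h6 : (1 + τ * ε⁻¹ * (-η₂ + ε * κ)) * N (y s)
      = N (y s) + τ * (-(η₂ / ε) * N (y s) + κ * N (y s)) := by
    field_simp
  have h7 : ρ = -(η₂ / ε) * N (y s) + κ * N (y s) + H + κ := by linarith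
  rw [h4]
  refine (map_add_le_add _ _ _).trans ?_
  rw [h5, h7]
  have h8 := h3 (y s)
  rw [h6] at h8
  have h9 := mul_pos hτ0 hκ0
  linarith

end Estimates

/-! ### Comparison of the coupled inequalities -/

/-- The comparison argument: `X` and `Y` satisfy the coupled differential inequalities of the
slow and the fast variable. -/
theorem comparison_estimate {X Y : ℝ → ℝ} {t η₁ η₂ ε g C ω δ σ : ℝ} (ht : 0 ≤ t)
    (hX : ContinuousOn X (Icc 0 t)) (hY : ContinuousOn Y (Icc 0 t)) (hX0 : ∀ s, 0 ≤ X s)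
    (hY0 : ∀ s, 0 ≤ Y s) (hη₁ : 0 < η₁) (hη₂ : 0 < η₂) (hε : 0 < ε) (hg : 0 ≤ g) (hC : 0 ≤ C)
    (hω : 0 ≤ ω) (hωδ : ω ≤ δ) (hXδ : X 0 ≤ δ) (hYδ : Y 0 ≤ δ)
    (hDX : ∀ s ∈ Ico 0 t, UpperDiniLE X s (-η₁ * X s + g * Y s))
    (hDY : ∀ s ∈ Ico 0 t, UpperDiniLE Y s (-(η₂ / ε) * Y s + C * X s + ω))
    (h1 : ε * η₁ ≤ η₂ / 2) (h2 : ε * (2 * g / η₂ * C) ≤ η₁ / 2) (h3 : ε * (2 * g / η₂) ≤ 1)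
    (h4 : ε * (C * (δ * (2 + 2 / η₁)) / η₂) ≤ σ)
    (h5 : ε * (2 * g / η₂ * (δ + δ / η₁ + C * (δ * (2 + 2 / η₁)) / η₁)) ≤ σ) :
    X t ≤ Real.exp (-η₁ * t) * X 0 + ε * g * ω / (η₁ * η₂) + σ ∧
      Y t ≤ Real.exp (-η₂ * t / ε) * Y 0 + ε * ω / η₂ + σ := by
  have hδ : 0 ≤ δ := hω.trans hωδ
  set α := η₂ / ε with hα
  have hα0 : 0 < α := by positivity
  have hεα : ε * α = η₂ := mul_div_cancel₀ _ hε.ne'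
  have hα2 : 2 * η₁ ≤ α := by rw [hα, le_div_iff₀ hε]; linarith
  -- Solves `l α = g + l η₁`: in `X + l Y` the gain `g Y` is cancelled and `l Y` still decays at
  -- rate exactly `η₁`.
  set l := g / (α - η₁) with hl
  have hαη : 0 < α - η₁ := by linarith
  have hl0 : 0 ≤ l := by positivity
  have hlα : l * α = g + l * η₁ := by
    have : l * (α - η₁) = g := div_mul_cancel₀ _ hαη.ne'
    linarith
  -- An upper bound for `l` that is linear in `ε`; it holds because `α - η₁ ≥ α / 2`.
  set Λ := ε * (2 * g / η₂) with hΛ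
  have hΛα : Λ * α = 2 * g := by
    rw [hΛ]
    calc ε * (2 * g / η₂) * α = (ε * α) * (2 * g / η₂) := by ring
      _ = 2 * g := by rw [hεα]; field_simp
  have hlΛ : l ≤ Λ := by
    refine le_of_mul_le_mul_right ?_ hα0
    have := mul_le_mul_of_nonneg_left hα2 hl0
    linarith
  set B := δ * (2 + 2 / η₁) with hB
  have hB0 : 0 ≤ B := by positivity
  have hV : ContinuousOn (fun s => X s + l * Y s) (Icc 0 t) := hX.add (hY.const_mul l)
  have hl1 : l ≤ 1 := hlΛ.trans h3
  have hlC : l * C ≤ η₁ / 2 := by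
    have := mul_le_mul_of_nonneg_right hlΛ hC
    have h6 : Λ * C ≤ η₁ / 2 := by rw [hΛ, mul_assoc]; exact h2
    linarith
  have hV0 : X 0 + l * Y 0 ≤ 2 * δ := by
    have := mul_le_mul hl1 hYδ (hY0 0) zero_le_one
    linarith
  have hDV : ∀ s ∈ Ico 0 t, UpperDiniLE (fun s => X s + l * Y s) s
      (-η₁ * X s + g * Y s + l * (-α * Y s + C * X s + ω)) := fun s hs =>
    (hDX s hs).add_const_mul hl0 (hDY s hs)
  -- A priori bound: the feedback `l C X` costs half of the rate `η₁`, so `X ≤ 2 δ + δ / (η₁ / 2) =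
  -- B`.
  have hXB : ∀ s ∈ Icc 0 t, X s ≤ B := by
    intro s hs
    have key := le_of_upperDiniLE (φ := fun s => X s + l * Y s) (α := η₁ / 2) (B := δ)
      (half_pos hη₁) hδ hV (fun u hu => (hDV u hu).mono ?_) hs
    · beta_reduce at key
      have h6 : Real.exp (-(η₁ / 2) * s) ≤ 1 := Real.exp_le_one_iff.2 (by nlinarith [hs.1])
      have h7 : Real.exp (-(η₁ / 2) * s) * (X 0 + l * Y 0) ≤ 2 * δ :=
        (mul_le_of_le_one_left (add_nonneg (hX0 0) (mul_nonneg hl0 (hY0 0))) h6).trans hV0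
      have h8 : δ / (η₁ / 2) = δ * (2 / η₁) := by field_simp
      have h9 := mul_nonneg hl0 (hY0 s)
      rw [hB]
      linarith
    · have h6 := mul_le_mul_of_nonneg_right hlC (hX0 u)
      have h7 : l * ω ≤ δ := (mul_le_of_le_one_left hω hl1).trans hωδ
      have h8 : 0 ≤ l * η₁ * Y u := mul_nonneg (mul_nonneg hl0 hη₁.le) (hY0 u)
      have h9 : l * α * Y u = g * Y u + l * η₁ * Y u := by rw [hlα]; ring
      linarith
  have hωB : 0 ≤ C * B + ω := by positivity
  constructor
  -- Second pass: with `C X ≤ C B` treated as forcing, the full rate `η₁` is recovered.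
  · have key := le_of_upperDiniLE (φ := fun s => X s + l * Y s) (α := η₁) (B := l * (C * B + ω))
      hη₁ (by positivity) hV (fun u hu => (hDV u hu).mono ?_) (right_mem_Icc.2 ht)
    · beta_reduce at key
      have h6 : Real.exp (-η₁ * t) ≤ 1 := Real.exp_le_one_iff.2 (by nlinarith)
      have h7 : Real.exp (-η₁ * t) * (l * Y 0) ≤ Λ * δ :=
        (mul_le_of_le_one_left (mul_nonneg hl0 (hY0 0)) h6).trans
          (mul_le_mul hlΛ hYδ (hY0 0) (hl0.trans hlΛ))
      -- All of the left side is `O(Λ)` and goes into `σ`; the gain term of the conclusion is added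
      -- only as a nonnegative quantity.
      have h8 : l * (C * B + ω) / η₁ ≤ Λ * (C * B / η₁ + δ / η₁) + ε * g * ω / (η₁ * η₂) := by
        have h9 : l * (C * B) ≤ Λ * (C * B) := mul_le_mul_of_nonneg_right hlΛ (by positivity)
        have h10 : l * ω ≤ Λ * δ := mul_le_mul hlΛ hωδ hω (hl0.trans hlΛ)
        have h11 : l * (C * B + ω) / η₁ ≤ Λ * (C * B + δ) / η₁ :=
          div_le_div_of_nonneg_right (by linarith) hη₁.le
        have h12 : 0 ≤ ε * g * ω / (η₁ * η₂) := by positivity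
        have h13 : Λ * (C * B + δ) / η₁ = Λ * (C * B / η₁ + δ / η₁) := by ring
        linarith
      have h14 : Λ * (δ + δ / η₁ + C * B / η₁) ≤ σ := by rw [hΛ, mul_assoc]; exact h5
      have h15 := mul_nonneg hl0 (hY0 t)
      linarith
    · have h6 := mul_le_mul_of_nonneg_left (hXB u ⟨hu.1, hu.2.le⟩) (mul_nonneg hl0 hC)
      have h9 : l * α * Y u = g * Y u + l * η₁ * Y u := by rw [hlα]; ring
      linarith
  · have key := le_of_upperDiniLE (φ := Y) (α := α) (B := C * B + ω) hα0 hωB hY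
      (fun u hu => (hDY u hu).mono ?_) (right_mem_Icc.2 ht)
    · have h6 : -α * t = -η₂ * t / ε := by rw [hα]; ring
      have h7 : (C * B + ω) / α = ε * (C * B / η₂) + ε * ω / η₂ := by
        rw [hα]; field_simp
      rw [h6, h7] at key
      linarith
    · have h6 := mul_le_mul_of_nonneg_left (hXB u ⟨hu.1, hu.2.le⟩) hC
      linarith

theorem exists_forall_mul_le {εbar : ℝ} (hεbar : 0 < εbar) (S : Finset (ℝ × ℝ))
    (hS : ∀ p ∈ S, 0 < p.2) :
    ∃ εstar ∈ Ioc 0 εbar, ∀ ε ∈ Ioc 0 εstar, ∀ p ∈ S, ε * p.1 ≤ p.2 := by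
  have h1 : ∀ᶠ ε in 𝓝[>] (0 : ℝ), ∀ p ∈ S, ε * p.1 ≤ p.2 := by
    refine (Finset.eventually_all S).2 fun p hp => nhdsWithin_le_nhds ?_
    have : Tendsto (fun ε : ℝ => ε * p.1) (𝓝 0) (𝓝 (0 * p.1)) :=
      (continuous_id.mul continuous_const).tendsto 0
    exact this.eventually_le_const (by simpa using hS p hp)
  obtain ⟨u, hu, hsub⟩ := (mem_nhdsGT_iff_exists_Ioc_subset).1 h1
  exact ⟨min u εbar, ⟨lt_min hu hεbar, min_le_right _ _⟩, fun ε hε =>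
    hsub ⟨hε.1, hε.2.trans (min_le_left _ _)⟩⟩

/-! ### Picard iteration in a weighted norm -/

section GlobalExistence

variable {E : Type*} [NormedAddCommGroup E] [NormedSpace ℝ E]

theorem integral_exp_mul_le {l : ℝ} (hl : 0 < l) (t : ℝ) :
    ∫ s in (0 : ℝ)..t, Real.exp (l * s) ≤ Real.exp (l * t) / l := by
  rw [intervalIntegral.integral_comp_mul_left _ hl.ne', integral_exp, smul_eq_mul, mul_zero,
    Real.exp_zero, inv_mul_eq_div]
  exact div_le_div_of_nonneg_right (by linarith) hl.le

/-- The factor `1 / l` gained by integrating against `e^{ls}` is what makes the Picard map contract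
for large `l`. -/
theorem exp_neg_mul_norm_integral_le {l D : ℝ} (hl : 0 < l) (hD : 0 ≤ D) {t : ℝ} (ht : 0 ≤ t)
    {k : ℝ → E} (hbd : ∀ s, 0 ≤ s → ‖k s‖ ≤ D * Real.exp (l * s)) :
    Real.exp (-l * t) * ‖∫ s in (0 : ℝ)..t, k s‖ ≤ D / l := by
  have h1 : ‖∫ s in (0 : ℝ)..t, k s‖ ≤ ∫ s in (0 : ℝ)..t, D * Real.exp (l * s) :=
    intervalIntegral.norm_integral_le_of_norm_le ht
      (Eventually.of_forall fun s hs => hbd s hs.1.le)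
      ((by fun_prop : Continuous fun s : ℝ => D * Real.exp (l * s)).intervalIntegrable
        (μ := volume) 0 t)
  rw [intervalIntegral.integral_const_mul] at h1
  have h2 := h1.trans (mul_le_mul_of_nonneg_left (integral_exp_mul_le hl t) hD)
  calc Real.exp (-l * t) * ‖∫ s in (0 : ℝ)..t, k s‖
      ≤ Real.exp (-l * t) * (D * (Real.exp (l * t) / l)) :=
        mul_le_mul_of_nonneg_left h2 (Real.exp_pos _).le
    _ = (Real.exp (-l * t) * Real.exp (l * t)) * (D / l) := by ring
    _ = D / l := by rw [← Real.exp_add]; simp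

variable [CompleteSpace E]

open scoped BoundedContinuousFunction in
/-- Global solvability of `u' = Φ (u + W t)`, `u 0 = u₀`, on `[0, ∞)` for Lipschitz `Φ` and a
continuous input `W` of linear growth. -/
theorem exists_global_solution {Φ : E → E} {K : NNReal} (hΦ : LipschitzWith K Φ) {W : ℝ → E}
    (hW : Continuous W) {b : ℝ} (hb : 0 ≤ b) (hWb : ∀ t, 0 ≤ t → ‖W t‖ ≤ b * t) (u₀ : E) :
    ∃ u : ℝ → E, u 0 = u₀ ∧ Continuous u ∧ ∀ t, 0 ≤ t → HasDerivAt u (Φ (u t + W t)) t := by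
  -- Gives `K / l ≤ 1 / 2` for the contraction, and `1 ≤ l` so that `s ≤ e^{ls}` controls the linear
  -- growth of `W`.
  set l : ℝ := 2 * K + 1 with hl
  have hl0 : 0 < l := by positivity
  have hl1 : 1 ≤ l := by rw [hl]; linarith [K.2]
  let k : (ℝ →ᵇ E) → ℝ → E := fun v s => Φ (Real.exp (l * s) • v s + W s)
  have hk : ∀ v, Continuous (k v) := fun v =>
    hΦ.continuous.comp (((by fun_prop : Continuous fun s : ℝ => Real.exp (l * s)).smul
      v.continuous).add hW)
  have hk_int : ∀ v, Continuous fun t : ℝ => ∫ s in (0 : ℝ)..t, k v s := fun v =>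
    intervalIntegral.continuous_primitive (fun a b => (hk v).intervalIntegrable a b) 0
  have hΦb : ∀ z, ‖Φ z‖ ≤ ‖Φ 0‖ + K * ‖z‖ := fun z => by
    have h1 := hΦ.norm_sub_le z 0
    rw [sub_zero] at h1
    have h2 := norm_le_norm_add_norm_sub' (Φ z) (Φ 0)
    linarith
  have hk_bd : ∀ v s, 0 ≤ s → ‖k v s‖ ≤ (‖Φ 0‖ + K * (‖v‖ + b)) * Real.exp (l * s) := by
    intro v s hs
    have h1 : 1 ≤ Real.exp (l * s) := Real.one_le_exp (by positivity)
    have h2 : s ≤ Real.exp (l * s) := by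
      have h3 := Real.add_one_le_exp (l * s)
      nlinarith
    have h4 : ‖Real.exp (l * s) • v s + W s‖ ≤ (‖v‖ + b) * Real.exp (l * s) := by
      refine (norm_add_le _ _).trans ?_
      rw [norm_smul, Real.norm_of_nonneg (Real.exp_pos _).le]
      have h5 := mul_le_mul_of_nonneg_left (v.norm_coe_le_norm s) (Real.exp_pos (l * s)).le
      have h6 := (hWb s hs).trans (mul_le_mul_of_nonneg_left h2 hb)
      linarith
    have h7 := mul_le_mul_of_nonneg_left h4 K.2
    have h8 := mul_le_mul_of_nonneg_left h1 (norm_nonneg (Φ 0))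
    have h9 := hΦb (Real.exp (l * s) • v s + W s)
    change ‖Φ _‖ ≤ _
    simp only [NNReal.val_eq_coe] at h7
    linarith
  -- The unknown is `v(t) = e^{-lt} u(t)`. Taking `|t|` extends it evenly to a bounded function on
  -- `ℝ`; only `t ≥ 0` matters.
  let P : (ℝ →ᵇ E) → (ℝ →ᵇ E) := fun v => BoundedContinuousFunction.ofNormedAddCommGroup
    (fun t => Real.exp (-l * |t|) • (u₀ + ∫ s in (0 : ℝ)..|t|, k v s))
    ((by fun_prop : Continuous fun t : ℝ => Real.exp (-l * |t|)).smul
      (continuous_const.add ((hk_int v).comp continuous_abs)))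
    (‖u₀‖ + (‖Φ 0‖ + K * (‖v‖ + b)) / l) (fun t => by
      rw [norm_smul, Real.norm_of_nonneg (Real.exp_pos _).le]
      have h1 := exp_neg_mul_norm_integral_le hl0
        (show 0 ≤ ‖Φ 0‖ + K * (‖v‖ + b) by positivity) (abs_nonneg t) (hk_bd v)
      have h2 : Real.exp (-l * |t|) * ‖u₀‖ ≤ ‖u₀‖ :=
        mul_le_of_le_one_left (norm_nonneg _)
          (Real.exp_le_one_iff.2 (by nlinarith [abs_nonneg t]))
      have h3 := mul_le_mul_of_nonneg_left
        (norm_add_le u₀ (∫ s in (0 : ℝ)..|t|, k v s)) (Real.exp_pos (-l * |t|)).le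
      linarith)
  have hP : ∀ v t, P v t = Real.exp (-l * |t|) • (u₀ + ∫ s in (0 : ℝ)..|t|, k v s) :=
    fun v t => rfl
  have hcontr : ContractingWith (1 / 2) P := by
    refine ⟨by rw [← NNReal.coe_lt_coe]; norm_num, LipschitzWith.of_dist_le_mul fun v v' => ?_⟩
    rw [BoundedContinuousFunction.dist_le (by positivity)]
    intro t
    have h1 : ∀ s, 0 ≤ s → ‖k v s - k v' s‖ ≤ (K * dist v v') * Real.exp (l * s) := by
      intro s _
      refine (hΦ.norm_sub_le _ _).trans ?_
      rw [add_sub_add_right_eq_sub, ← smul_sub, norm_smul,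
        Real.norm_of_nonneg (Real.exp_pos _).le, ← dist_eq_norm]
      have h2 := mul_le_mul_of_nonneg_left
        (BoundedContinuousFunction.dist_coe_le_dist (f := v) (g := v') s)
        (Real.exp_pos (l * s)).le
      have h3 := mul_le_mul_of_nonneg_left h2 K.2
      simp only [NNReal.val_eq_coe] at h3
      linarith
    have h2 := exp_neg_mul_norm_integral_le hl0 (by positivity) (abs_nonneg t) h1
    rw [intervalIntegral.integral_sub ((hk v).intervalIntegrable _ _)
      ((hk v').intervalIntegrable _ _)] at h2
    rw [hP, hP, dist_eq_norm, ← smul_sub, add_sub_add_left_eq_sub, norm_smul,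
      Real.norm_of_nonneg (Real.exp_pos _).le]
    refine h2.trans ?_
    rw [div_le_iff₀ hl0, hl]
    have h3 : 0 ≤ dist v v' := dist_nonneg
    push_cast
    linarith
  obtain ⟨v, hv⟩ : ∃ v, P v = v := ⟨_, hcontr.fixedPoint_isFixedPt⟩
  have hv' : ∀ t, 0 ≤ t → Real.exp (l * t) • v t = u₀ + ∫ s in (0 : ℝ)..t, k v s := by
    intro t ht
    have h1 := hP v t
    rw [hv, abs_of_nonneg ht] at h1
    rw [h1, smul_smul, ← Real.exp_add]
    simp
  -- Defining `u` by the integral for all real `t` makes the derivative two-sided even at `0`, where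
  -- the even extension need not be differentiable.
  refine ⟨fun t => u₀ + ∫ s in (0 : ℝ)..t, k v s, by simp, continuous_const.add (hk_int v),
    fun t ht => ?_⟩
  beta_reduce
  rw [← hv' t ht]
  exact ((hk v).integral_hasStrictDerivAt 0 t).hasDerivAt.const_add u₀

end GlobalExistence

/-! ### Existence of solutions of the platoon system -/

section Solution

variable {n r : ℕ} {d : Fin n → (Fin n → ℝ) → ℝ}

theorem hasDerivAt_h_comp (hd : ∀ i, ContDiff ℝ 1 (d i)) {x : ℝ → Fin n → ℝ} {v : Fin n → ℝ}
    {t : ℝ} (hx : HasDerivAt x v t) :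
    HasDerivAt (fun s => h d (x s)) ((jacobian (h d) (x t)).mulVec v) t := by
  refine hasDerivAt_pi.2 fun i => ?_
  have h1 : ContDiff ℝ 1 fun x => h d x i := contDiff_pi.1 (contDiff_h hd) i
  have h2 := ((h1.differentiable one_ne_zero (x t)).hasFDerivAt).comp_hasDerivAt t hx
  refine HasDerivAt.congr_deriv h2 ?_
  have h3 : v = ∑ j, v j • Pi.single (M := fun _ => ℝ) j 1 := by
    ext k; simp [Finset.sum_apply, Pi.single_apply]
  conv_lhs => rw [h3, map_sum]
  simp only [map_smul, smul_eq_mul, Matrix.mulVec, dotProduct, jacobian, Matrix.of_apply, pderiv]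
  exact Finset.sum_congr rfl fun j _ => mul_comm _ _

/-- Along a solution, `u₂ = y + h(x) - W` with `W = ∫ w` satisfies `u₂' = ε⁻¹ A y`. Hence `(x, u₂)`
solves an equation with globally Lipschitz right-hand side, driven by the continuous input `W`;
conversely `y = u₂ + W - h(x)` recovers a Carathéodory solution. -/
theorem exists_isSolutionOn (hd : ∀ i, ContDiff ℝ 1 (d i)) (hloc : DependsOnNeighbours d)
    {c : ℝ} (hc : 0 ≤ c) (hbound : BoundCondition d c) (kbar : Fin n → ℝ) {ε : ℝ} (hε : 0 < ε)
    (x₀ y₀ : Fin n → ℝ) {w : ℝ → Fin n → ℝ}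
    (hw : AEMeasurable w (volume.restrict (Ici (0 : ℝ)))) {b : ℝ} (hb : 0 ≤ b)
    (hwb : ∀ᵐ s ∂volume.restrict (Ici (0 : ℝ)), ‖w s‖ ≤ b) :
    ∃ x y : ℝ → Fin n → ℝ, x 0 = x₀ ∧ y 0 = y₀ ∧
      ∀ T, 0 ≤ T → IsSolutionOn d r kbar ε w T x y := by
  have hdiff : ∀ i, Differentiable ℝ (d i) := fun i => (hd i).differentiable one_ne_zero
  set w' : ℝ → Fin n → ℝ := (Ici (0 : ℝ)).indicator w with hw'
  have hw'm : AEStronglyMeasurable w' volume :=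
    (aestronglyMeasurable_indicator_iff measurableSet_Ici).2 hw.aestronglyMeasurable
  have hw'b : ∀ᵐ s, ‖w' s‖ ≤ b := by
    filter_upwards [(ae_restrict_iff' measurableSet_Ici).1 hwb] with s hs
    by_cases h0 : s ∈ Ici (0 : ℝ)
    · rw [hw', indicator_of_mem h0]; exact hs h0
    · rw [hw', indicator_of_notMem h0, norm_zero]; exact hb
  have hw'i : ∀ p q, IntervalIntegrable w' volume p q := fun p q =>
    (intervalIntegrable_const (c := b)).mono_fun' hw'm.restrict (ae_restrict_of_ae hw'b)
  have hw'eq : ∀ {t : ℝ}, 0 ≤ t → EqOn w' w (uIcc 0 t) := fun ht s hs => by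
    rw [uIcc_of_le ht] at hs
    exact indicator_of_mem (mem_Ici.2 hs.1) _
  set W : ℝ → Fin n → ℝ := fun t => ∫ s in (0 : ℝ)..t, w' s with hW
  have hWc : Continuous W := intervalIntegral.continuous_primitive hw'i 0
  have hWb : ∀ t, 0 ≤ t → ‖W t‖ ≤ b * t := fun t ht => by
    have := intervalIntegral.norm_integral_le_of_norm_le_const_ae (a := 0) (b := t) (f := w')
      (C := b) (hw'b.mono fun s hs _ => hs)
    rwa [sub_zero, abs_of_nonneg ht] at this
  let LG := (Matrix.mulVecLin (G n)).toContinuousLinearMap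
  let LA := (Matrix.mulVecLin (A r kbar)).toContinuousLinearMap
  have hfL : LipschitzWith (2 * c).toNNReal (f d) := LipschitzWith.of_dist_le_mul fun u v => by
    rw [dist_eq_norm, dist_eq_norm, Real.coe_toNNReal _ (by positivity)]
    exact norm_f_sub_le hdiff hloc hc hbound u v
  have hhL : LipschitzWith (n * (2 * c)).toNNReal (h d) :=
    LipschitzWith.of_dist_le_mul fun u v => by
      rw [dist_eq_norm, dist_eq_norm, Real.coe_toNNReal _ (by positivity)]
      exact norm_h_sub_le hdiff hloc hc hbound u v
  have hyL := (LipschitzWith.prod_snd (α := Fin n → ℝ) (β := Fin n → ℝ)).sub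
    (hhL.comp LipschitzWith.prod_fst)
  have hΦL := ((hfL.comp LipschitzWith.prod_fst).add (LG.lipschitz.comp hyL)).prodMk
    ((ε⁻¹ • LA).lipschitz.comp hyL)
  obtain ⟨u, hu0, huc, hu⟩ := exists_global_solution hΦL
    (W := fun t => ((0 : Fin n → ℝ), W t)) (continuous_const.prodMk hWc) hb
    (fun t ht => by simpa [Prod.norm_def] using hWb t ht) (x₀, y₀ + h d x₀)
  set x : ℝ → Fin n → ℝ := fun t => (u t).1 with hx
  set z : ℝ → Fin n → ℝ := fun t => (u t).2 - h d (x t) with hz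
  set y : ℝ → Fin n → ℝ := fun t => z t + W t with hy
  have hxc : Continuous x := continuous_fst.comp huc
  have hyc : Continuous y :=
    ((continuous_snd.comp huc).sub ((contDiff_h hd).continuous.comp hxc)).add hWc
  have hyt : ∀ t, (u t).2 + W t - h d (x t) = y t := fun t => by
    simp only [hy, hz]; abel
  have hdx : ∀ t, 0 ≤ t → HasDerivAt x (f d (x t) + (G n).mulVec (y t)) t := fun t ht => by
    have h1 := (hasFDerivAt_fst (𝕜 := ℝ) (p := u t)).comp_hasDerivAt t (hu t ht)
    rw [← hyt]
    convert! h1 using 1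
    simp [LG, hx]
  have hdz : ∀ t, 0 ≤ t → HasDerivAt z (ε⁻¹ • ((A r kbar).mulVec (y t)
      - ε • (jacobian (h d) (x t)).mulVec (f d (x t) + (G n).mulVec (y t)))) t := fun t ht => by
    have h1 := (hasFDerivAt_snd (𝕜 := ℝ) (p := u t)).comp_hasDerivAt t (hu t ht)
    have h2 := h1.sub (hasDerivAt_h_comp hd (hdx t ht))
    rw [smul_sub, inv_smul_smul₀ hε.ne']
    convert! h2 using 1
    rw [← hyt t]
    simp [LA, hx]
  have hcx : Continuous fun t => f d (x t) + (G n).mulVec (y t) :=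
    ((continuous_f hd).comp hxc).add (continuous_const.matrix_mulVec hyc)
  have hcz : Continuous fun t => ε⁻¹ • ((A r kbar).mulVec (y t)
      - ε • (jacobian (h d) (x t)).mulVec (f d (x t) + (G n).mulVec (y t))) :=
    (continuous_fast_field hd r kbar ε).comp (hxc.prodMk hyc)
  have hx0 : x 0 = x₀ := by simp only [hx, hu0]
  have hy0 : y 0 = y₀ := by
    rw [← hyt, hx0, hu0]
    simp [hW]
  refine ⟨x, y, hx0, hy0, fun T hT => ⟨(hw'i 0 T).congr fun s hs => hw'eq hT (uIoc_subset_uIcc hs),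
    hxc.continuousOn, hyc.continuousOn, fun t ht => ?_, fun t ht => ?_⟩⟩
  · rw [intervalIntegral.integral_eq_sub_of_hasDerivAt (f := x)
      (fun s hs => hdx s (by rw [uIcc_of_le ht.1] at hs; exact hs.1))
      (hcx.intervalIntegrable _ _)]
    abel
  · have h1 := intervalIntegral.integral_eq_sub_of_hasDerivAt (f := z)
      (fun s hs => hdz s (by rw [uIcc_of_le ht.1] at hs; exact hs.1))
      (hcz.intervalIntegrable 0 t)
    have h2 : ∫ s in (0 : ℝ)..t, ε⁻¹ • ((A r kbar).mulVec (y s)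
        - ε • (jacobian (h d) (x s)).mulVec (f d (x s) + (G n).mulVec (y s)) + ε • w s)
        = (z t - z 0) + W t := by
      rw [← h1, hW, ← intervalIntegral.integral_add (hcz.intervalIntegrable 0 t) (hw'i 0 t)]
      refine intervalIntegral.integral_congr fun s hs => ?_
      rw [smul_add, inv_smul_smul₀ hε.ne', hw'eq ht.1 hs]
    have h3 : y 0 = z 0 := by simp [hy, hW]
    rw [h2, h3]
    simp only [hy]
    abel

end Solution

end Platoon

/-! ### The main theorem -/

theorem theorem1 (n r : ℕ) (hr : 1 ≤ r) (hrn : r ≤ n)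
    (e : Fin n → ℝ) (d : Fin n → (Fin n → ℝ) → ℝ)
    (hd_smooth : ∀ i, ContDiff ℝ 1 (d i))
    (hd_local : Platoon.DependsOnNeighbours d)
    (hd_eq : ∀ i, d i e = 0)
    (η₁ c : ℝ) (hη₁ : 0 < η₁) (hc : 0 < c)
    (hd_sign : Platoon.SignSumCondition d η₁)
    (hd_bound : Platoon.BoundCondition d c)
    (kbar : Fin n → ℝ) (εbar : ℝ) (hεbar : 0 < εbar)
    (hkbar : ∀ i, -kbar i + 2 * εbar * c * ((r : ℝ) - 1) < 0) :
    (∃ (q : Fin (n ⌈/⌉ r) → ℝ) (η₂ : ℝ), Platoon.IsContractionPair d r kbar εbar q η₂) ∧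
    ∀ (q : Fin (n ⌈/⌉ r) → ℝ) (η₂ : ℝ), Platoon.IsContractionPair d r kbar εbar q η₂ →
      ∀ δ > (0 : ℝ), ∀ σ > (0 : ℝ), ∃ εstar ∈ Ioc 0 εbar, ∀ ε ∈ Ioc 0 εstar,
        ∀ (x₀ y₀ : Fin n → ℝ) (w : ℝ → Fin n → ℝ),
          AEMeasurable w (volume.restrict (Ici (0 : ℝ))) →
          ‖x₀ - e‖ ≤ δ → Platoon.starNorm q y₀ ≤ δ →
          Platoon.signalNorm (Platoon.starNorm q) w ≤ ENNReal.ofReal δ →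
          (∃ x y : ℝ → Fin n → ℝ, x 0 = x₀ ∧ y 0 = y₀ ∧
            ∀ T, 0 ≤ T → Platoon.IsSolutionOn d r kbar ε w T x y) ∧
          ∀ (T : ℝ) (x y : ℝ → Fin n → ℝ), Platoon.IsSolutionOn d r kbar ε w T x y →
            x 0 = x₀ → y 0 = y₀ → ∀ t ∈ Icc 0 T,
              ‖x t - e‖ ≤ Real.exp (-η₁ * t) * ‖x 0 - e‖
                + ε * Platoon.normGInftyStar q
                  * (Platoon.signalNorm (Platoon.starNorm q) (Platoon.truncate t w)).toReal
                    / (η₁ * η₂) + σ ∧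
              Platoon.starNorm q (y t) ≤ Real.exp (-η₂ * t / ε) * Platoon.starNorm q (y 0)
                + ε * (Platoon.signalNorm (Platoon.starNorm q) (Platoon.truncate t w)).toReal
                  / η₂ + σ := by
  have hdiff : ∀ i, Differentiable ℝ (d i) := fun i => (hd_smooth i).differentiable one_ne_zero
  refine ⟨Platoon.exists_isContractionPair hr hrn hdiff hd_local hc hd_sign hd_bound hεbar hkbar,
    ?_⟩
  rintro q η₂ ⟨hq, hη₂, hμ⟩ δ hδ σ hσ
  obtain ⟨Q, hQ0, hQ⟩ := Platoon.exists_norm_le_mul_starNorm hr hq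
  obtain ⟨C₀, hC₀, hC⟩ := Platoon.exists_starNorm_le_mul_norm hq
  set N := Platoon.starSeminorm q hq with hN
  set g := Platoon.normGInftyStar q with hg
  have hg0 : 0 ≤ g := Platoon.normGInftyStar_nonneg q
  set C : ℝ := C₀ * (n * c * (2 * c)) with hCdef
  have hC0 : 0 ≤ C := by positivity
  have hHf : ∀ x, N ((Platoon.jacobian (Platoon.h d) x).mulVec (Platoon.f d x))
      ≤ C * ‖x - e‖ := fun x => by
    have h1 := Platoon.norm_f_sub_le hdiff hd_local hc.le hd_bound x e
    have h2 : Platoon.f d e = 0 := funext fun i => by simp [Platoon.f, hd_eq]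
    rw [h2, sub_zero] at h1
    have h3 := Platoon.norm_jacobian_h_mulVec_le hdiff hd_local hc.le hd_sign hd_bound x
      (Platoon.f d x)
    calc N ((Platoon.jacobian (Platoon.h d) x).mulVec (Platoon.f d x))
        ≤ C₀ * ‖(Platoon.jacobian (Platoon.h d) x).mulVec (Platoon.f d x)‖ := hC _
      _ ≤ C₀ * (n * c * (2 * c * ‖x - e‖)) := by gcongr; exact h3.trans (by gcongr)
      _ = C * ‖x - e‖ := by rw [hCdef]; ring
  -- These are the five smallness conditions of `comparison_estimate`; their constants involve
  -- neither `ε` nor the data `x₀`, `y₀`, `w`.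
  obtain ⟨εstar, hεstar, hsmall⟩ := Platoon.exists_forall_mul_le hεbar
    {(η₁, η₂ / 2), (2 * g / η₂ * C, η₁ / 2), (2 * g / η₂, 1),
      (C * (δ * (2 + 2 / η₁)) / η₂, σ),
      (2 * g / η₂ * (δ + δ / η₁ + C * (δ * (2 + 2 / η₁)) / η₁), σ)}
    (by simp [hη₁, hη₂, hσ])
  refine ⟨εstar, hεstar, fun ε hε x₀ y₀ w hw hx₀ hy₀ hwδ => ?_⟩
  have hsm := hsmall ε hε
  simp only [Finset.mem_insert, Finset.mem_singleton, forall_eq_or_imp, forall_eq] at hsm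
  obtain ⟨h1, h2, h3, h4, h5⟩ := hsm
  have hε' : ε ∈ Ioc 0 εbar := ⟨hε.1, hε.2.trans hεstar.2⟩
  have hN0 : ∀ a, 0 ≤ Platoon.starNorm q a := fun a => norm_nonneg _
  refine ⟨?_, fun T x y hsol hx0 hy0 t ht => ?_⟩
  · have hwtop : Platoon.signalNorm (Platoon.starNorm q) w ≠ ⊤ :=
      (hwδ.trans_lt ENNReal.ofReal_lt_top).ne
    refine Platoon.exists_isSolutionOn hd_smooth hd_local hc.le hd_bound kbar hε.1 x₀ y₀ hw
      (b := Q * (Platoon.signalNorm (Platoon.starNorm q) w).toReal) (by positivity) ?_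
    filter_upwards [Platoon.ae_le_toReal_signalNorm hN0 hwtop] with s hs
    exact (hQ _).trans (mul_le_mul_of_nonneg_left hs hQ0.le)
  · have hwt : Platoon.signalNorm (Platoon.starNorm q) (Platoon.truncate t w)
        ≤ ENNReal.ofReal δ :=
      (Platoon.signalNorm_truncate_le (map_zero N) t).trans hwδ
    have hwtop := (hwt.trans_lt ENNReal.ofReal_lt_top).ne
    have hω := Platoon.ae_le_toReal_signalNorm_truncate (t := t) (w := w) hN0 hwtop
    -- Restricting to `[0, t]` lets the norm of the truncated signal serve as the input bound `ω`.
    have hsol' := hsol.mono ht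
    refine Platoon.comparison_estimate (X := fun s => ‖x s - e‖)
      (Y := fun s => Platoon.starNorm q (y s)) (C := C) (δ := δ) ht.1
      (hsol'.continuousOn_x.sub continuousOn_const).norm
      ((Platoon.continuous_starSeminorm q hq).comp_continuousOn hsol'.continuousOn_y)
      (fun s => norm_nonneg _) (fun s => hN0 _) hη₁ hη₂ hε.1 hg0 hC0 ENNReal.toReal_nonneg
      (ENNReal.toReal_le_of_le_ofReal hδ.le hwt) (by rw [hx0]; exact hx₀)
      (by rw [hy0]; exact hy₀) ?_ ?_ h1 h2 h3 h4 h5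
    · exact fun s hs => hsol'.upperDiniLE_slow (N := N) hd_smooth hd_local hc hη₁ hd_sign
        hd_bound hd_eq (Platoon.norm_G_mulVec_le hr hq) hs
    · refine fun s hs => (hsol'.upperDiniLE_fast (N := N) (by omega) hε.1 hd_smooth
        (Platoon.continuous_starSeminorm q hq) hQ hC hC₀.le (hμ ε hε') hω hs).mono ?_
      have := hHf (x s)
      simp only [hN, Platoon.coe_starSeminorm] at this ⊢
      linarith
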